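/- Let $M$ be a non-empty smooth (Hausdorff) manifold without boundary, of dimension $m\ge 1$. Let $\mathrm{Diff}^c(M)$ be the group of smooth diffeomorphisms $\phi$ of $M$ whose support $\mathrm{supp}(\phi)=\overline{\{x : \phi(x)\ne x\}}$ is compact, with its $C^\infty$ topology: a set is open if and only if, for every compact $K\subset M$, its intersection with $\mathrm{Diff}_K(M)=\{\phi : \mathrm{supp}(\phi)\subset K\}$ is open in $\mathrm{Diff}_K(M)$ for the topology of uniform convergence of all derivatives in charts on compact sets. Let $\mathrm{Diff}^c_0(M)\subset\mathrm{Diff}^c(M)$ be the set of those $\phi$ for which there is a smooth isotopy $(\phi_t)_{t\in[0,1]}$ of diffeomorphisms from $\phi_0=\mathrm{Id}$ to $\phi_1=\phi$ whose supports all lie in one compact set, with the subspace topology. Let $\mathrm{Aut}(M)=\{\exp(X)\}$ be the set of time-$1$ maps of the flows of compactly supported smooth vector fields $X$ on $M$. Let $\mathcal W\subset \mathrm{Diff}^c_0(M)$ be any open neighbourhood of $\mathrm{Id}$. Then there exists $\phi\in\mathcal W$ such that $\phi\ne\psi^2$ for every $\psi\in\mathrm{Diff}^c(M)$. In particular, $\mathcal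 W\setminus\mathrm{Aut}(M)$ is not empty. -/

import Mathlib

open Set TopologicalSpace
open scoped Manifold ContDiff

namespace SmoothDiff

section
variable (m : ℕ) (M : Type*) [TopologicalSpace M] [ChartedSpace (EuclideanSpace ℝ (Fin m)) M]

/-- `Diff(M)`: the smooth diffeomorphisms of the `m`-dimensional manifold `M`. -/
abbrev Diff : Type _ := Diffeomorph (𝓡 m) (𝓡 m) M M ∞

/-- `Diff^c(M)`: the smooth diffeomorphisms of `M` whose support
`closure {x | φ x ≠ x}` is compact. -/
@[ext]
structure DiffC where
  /-- The underlying diffeomorphism. -/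
  toDiff : Diff m M
  /-- Its support is compact. -/
  isCompact_support : IsCompact (closure {x : M | toDiff x ≠ x})

end

section
variable {m : ℕ} {M : Type*} [TopologicalSpace M] [ChartedSpace (EuclideanSpace ℝ (Fin m)) M]

/-- The identity of `M`, as a compactly supported diffeomorphism. -/
noncomputable def DiffC.id : DiffC m M where
  toDiff := Diffeomorph.refl (𝓡 m) M ∞
  isCompact_support := by simp

/-- A basic set of the weak (compact-open) `C^∞` topology around `f`: all `g` which map the
compact set `L`, contained in the domain of the chart `c`, into the domain of the chart `d`, and
whose expression in these charts has all derivatives up to order `r` within `ε` of those of `f`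
on `L`. -/
def basicNhd (f : Diff m M) (c d : OpenPartialHomeomorph M (EuclideanSpace ℝ (Fin m)))
    (L : Set M) (r : ℕ) (ε : ℝ) : Set (Diff m M) :=
  {g | MapsTo g L d.source ∧ ∀ x ∈ L, ∀ j ≤ r,
    ‖iteratedFDeriv ℝ j (d ∘ g ∘ c.symm) (c x) - iteratedFDeriv ℝ j (d ∘ f ∘ c.symm) (c x)‖ < ε}

variable (m M) in
/-- The topology on `Diff(M)` of uniform convergence of all derivatives on compact sets
(in charts of the smooth structure). -/
@[reducible] def weakTopology : TopologicalSpace (Diff m M) :=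
  generateFrom {N | ∃ (f : Diff m M) (c d : OpenPartialHomeomorph M (EuclideanSpace ℝ (Fin m)))
    (L : Set M) (r : ℕ) (ε : ℝ),
    c ∈ IsManifold.maximalAtlas (𝓡 m) ∞ M ∧ d ∈ IsManifold.maximalAtlas (𝓡 m) ∞ M ∧
    IsCompact L ∧ L ⊆ c.source ∧ MapsTo f L d.source ∧ 0 < ε ∧ N = basicNhd f c d L r ε}

/-- `Diff_K(M)`: the elements of `Diff^c(M)` which are supported in `K`. -/
def DiffIn (K : Compacts M) : Type _ := {φ : DiffC m M // ∀ x ∉ K, φ.toDiff x = x}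

/-- The `C^∞` topology on `Diff_K(M)`. -/
instance instTopologicalSpaceDiffIn (K : Compacts M) : TopologicalSpace (DiffIn (m := m) K) :=
  (weakTopology m M).induced fun φ => φ.1.toDiff

/-- The `C^∞` topology on `Diff^c(M)`, the union of the `Diff_K(M)` over the compact sets `K`: a
set is open if and only if its trace on every `Diff_K(M)` is open. -/
instance instTopologicalSpaceDiffC : TopologicalSpace (DiffC m M) :=
  ⨆ K : Compacts M, coinduced (fun φ : DiffIn (m := m) K => φ.1) inferInstance

/-- `Φ` is a smooth compactly supported isotopy, parametrized by `[0, 1]`, from the identity to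
`φ`. (The values `Φ t` for `t` outside `[0, 1]` are irrelevant.) -/
structure IsIsotopyFromId (Φ : ℝ → Diff m M) (φ : Diff m M) : Prop where
  contMDiffOn : ContMDiffOn (𝓘(ℝ, ℝ).prod (𝓡 m)) (𝓡 m) ∞
    (fun p : ℝ × M => Φ p.1 p.2) (Icc (0 : ℝ) 1 ×ˢ univ)
  start : ∀ x, Φ 0 x = x
  finish : ∀ x, Φ 1 x = φ x
  support : ∃ K : Set M, IsCompact K ∧ ∀ t ∈ Icc (0 : ℝ) 1, closure {x | Φ t x ≠ x} ⊆ K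

variable (m M) in
/-- `Diff^c_0(M)`: the identity component of `Diff^c(M)`, i.e. the elements which are isotopic to
the identity through a compactly supported isotopy. -/
def DiffC0 : Set (DiffC m M) := {φ | ∃ Φ : ℝ → Diff m M, IsIsotopyFromId Φ φ.toDiff}

/-- `φ = exp X`: the map `φ` is the time `1` map of the flow of the vector field `X`. -/
def IsExp [IsManifold (𝓡 m) ∞ M] (X : ∀ x : M, TangentSpace (𝓡 m) x) (φ : Diff m M) : Prop :=
  ∀ x : M, ∃ γ : ℝ → M, IsMIntegralCurve (I := 𝓡 m) γ X ∧ γ 0 = x ∧ γ 1 = φ x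

variable (m M) in
/-- `Aut(M)`: the autonomous diffeomorphisms `exp X`, for `X` a smooth vector field on `M` with
compact support. -/
def Aut [IsManifold (𝓡 m) ∞ M] : Set (DiffC m M) :=
  {φ | ∃ X : ∀ x : M, TangentSpace (𝓡 m) x,
    ContMDiff (𝓡 m) (𝓡 m).tangent ∞ (fun x => (⟨x, X x⟩ : TangentBundle (𝓡 m) M)) ∧
    IsCompact (closure {x : M | X x ≠ 0}) ∧ IsExp X φ.toDiff}

/-- The identity is isotopic to itself. -/
theorem id_mem_DiffC0 : (DiffC.id : DiffC m M) ∈ DiffC0 m M :=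
  ⟨fun _ => Diffeomorph.refl (𝓡 m) M ∞,
    { contMDiffOn := contMDiff_snd.contMDiffOn
      start := fun _ => rfl
      finish := fun _ => rfl
      support := ⟨∅, isCompact_empty, by simp⟩ }⟩

end

end SmoothDiff

/-!
A neighbourhood `W` of the identity is entered through one-parameter families. If `u t` is a smooth
family of displacements, supported in a compact set of a chart, then `id + u t` extends to a
diffeomorphism of `M` as long as `u t` is a contraction. It is isotopic to the identity, and depends
continuously on `t` for the `C^∞` topology. Hence, once the extension of `id + u t₀` lies in `W`, so
does that of `id + u t` for `t` close to `t₀` (`eventually_exists_mem_of_family`). In both cases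
below this is used twice: a family issued from the identity, then a small perturbation of one of its
members.

*Dimension at least two.* If the points of even minimal period `n` of a bijection form one single
cycle, then it is not the square of any map (`not_exists_sqrt_of_unique_cycle`, after Milnor).
Rotate a neighbourhood of a circle of a chart by the angle `2 π / n`, for a large even `n`, then add
a rotation by `ε (1 - cos (n θ))` and a contraction towards the circle. Points off the circle
approach it and are not periodic, unless they are fixed; on the circle every step turns by at least
`2 π / n`, with equality only at the `n`-th roots of unity, so that these are the only points of
minimal period `n` (`exists_eq_iterate_of_minimalPeriod_eq`).

*Dimension one.* An increasing map of an interval has no cycle but its fixed points, and another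
argument is needed. Take a diffeomorphism supported in a coordinate interval, with a repelling fixed
point `-1` and an attracting fixed point `1`, near which it is affine. The germ of a differentiable
square root at these points is the homothety given by the positive square root of the multiplier
(`IsTameRoot.eventually_eq_sqrt`), and this germ determines the root on `(-1, 1)`: it can be
propagated by the dynamics from either end. Suppose that `g` is a square root, and modify the
diffeomorphism inside `(0, g 0)` only. A root of the modified map has to agree with `g` on
`(-1, g 0]`, as seen from `-1`, and on `[g 0, 1)`, as seen from `1`, and then its square has not been
modified (`IsTameRoot.eq_of_eqOn_compl`). So one of the two maps has no such root.

A smooth square root is tame, because it commutes with the map and so fixes the points `-1` and `1`,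
which are singled out by the dynamics (`isTameSqrt_of_diff`).

*Exponentials.* The time `1` map of a flow is the square of its time `1 / 2` map. In dimension at
least two no map at all is a square root. In dimension one the time `1 / 2` map is a tame square
root: the vector field is invariant under the time `1` map, which is a homothety near `-1` and `1`,
hence it is linear there and the flow is explicit (`isTameSqrt_flow_half`). This makes it
unnecessary to know that the flow is smooth.
-/

namespace SmoothDiff

/-! ### Continuity of smooth families of diffeomorphisms -/

section Topology

/-- The iterated derivatives in the space variable of a jointly smooth family of maps are jointly
smooth. -/
theorem contDiffAt_iteratedFDeriv_of_family {E F P : Type*} [NormedAddCommGroup E]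
    [NormedSpace ℝ E] [NormedAddCommGroup F] [NormedSpace ℝ F] [NormedAddCommGroup P]
    [NormedSpace ℝ P] {G : P → E → F} {p₀ : P} {y₀ : E}
    (hG : ContDiffAt ℝ ∞ (fun q : P × E => G q.1 q.2) (p₀, y₀)) (j : ℕ) :
    ContDiffAt ℝ ∞ (fun q : P × E => iteratedFDeriv ℝ j (G q.1) q.2) (p₀, y₀) := by
  induction j with
  | zero =>
    have : (fun q : P × E => iteratedFDeriv ℝ 0 (G q.1) q.2) =
        fun q : P × E => (continuousMultilinearCurryFin0 ℝ E F).symm (G q.1 q.2) := by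
      funext q; simp [iteratedFDeriv_zero_eq_comp]
    rw [this]
    exact (continuousMultilinearCurryFin0 ℝ E F).symm.contDiff.contDiffAt.comp _ hG
  | succ j ih =>
    have : (fun q : P × E => iteratedFDeriv ℝ (j + 1) (G q.1) q.2) =
        fun q : P × E => (continuousMultilinearCurryLeftEquiv ℝ (fun _ : Fin (j + 1) => E) F).symm
          (fderiv ℝ (iteratedFDeriv ℝ j (G q.1)) q.2) := by
      funext q; rw [iteratedFDeriv_succ_eq_comp_left]; rfl
    rw [this]
    have hI : ContDiff ℝ ∞
        (continuousMultilinearCurryLeftEquiv ℝ (fun _ : Fin (j + 1) => E) F).symm :=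
      LinearIsometryEquiv.contDiff (E := E →L[ℝ] (E [×j]→L[ℝ] F)) (F := E [×(j + 1)]→L[ℝ] F) _
    refine hI.contDiffAt.comp (p₀, y₀) ?_
    refine ContDiffAt.fderiv (n := ∞) (f := fun q : P × E => iteratedFDeriv ℝ j (G q.1))
      (g := fun q : P × E => q.2) ?_ contDiffAt_snd (by simp)
    exact ContDiffAt.comp (f := fun r : (P × E) × E => (r.1.1, r.2)) ((p₀, y₀), y₀) ih
      ((contDiffAt_fst.fst).prodMk contDiffAt_snd)

variable {m : ℕ} {M : Type*} [TopologicalSpace M] [ChartedSpace (EuclideanSpace ℝ (Fin m)) M]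

/-- A family of diffeomorphisms depending smoothly on `t` is continuous at `t₀` for the weak
topology: by compactness, uniform closeness on `L` is closeness near every point of `L`, which is
the joint continuity of the derivatives. -/
theorem continuousAt_weakTopology_of_family (F : ℝ → Diff m M) (t₀ : ℝ)
    (hs : ∀ x, ContMDiffAt (𝓘(ℝ, ℝ).prod (𝓡 m)) (𝓡 m) ∞ (fun p : ℝ × M => F p.1 p.2) (t₀, x)) :
    @ContinuousAt ℝ (Diff m M) _ (weakTopology m M) F t₀ := by
  let := weakTopology m M
  rw [ContinuousAt, tendsto_nhds_generateFrom_iff]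
  rintro _ ⟨f, c, d, L, r, ε, hc, hd, hL, hLc, hfL, hε, rfl⟩ ⟨hmaps, hclose⟩
  have key : ∀ᶠ t in nhds t₀, ∀ x ∈ L, F t x ∈ d.source ∧ ∀ j ≤ r,
      ‖iteratedFDeriv ℝ j (d ∘ F t ∘ c.symm) (c x) -
        iteratedFDeriv ℝ j (d ∘ f ∘ c.symm) (c x)‖ < ε := by
    apply hL.eventually_forall_of_forall_eventually
    intro x hx
    have hxc := hLc hx
    have hcx : ContinuousAt c x := c.continuousAt hxc
    have hcont : ContinuousAt (fun p : ℝ × M => F p.1 p.2) (t₀, x) := (hs x).continuousAt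
    have e1 : ∀ᶠ p : ℝ × M in nhds (t₀, x), F p.1 p.2 ∈ d.source :=
      hcont.eventually (d.open_source.mem_nhds (hmaps hx))
    have hsymm : ContMDiffAt (𝓡 m) (𝓡 m) ∞ c.symm (c x) :=
      contMDiffAt_symm_of_mem_maximalAtlas hc (c.map_source hxc)
    have hG : ContDiffAt ℝ ∞
        (fun q : ℝ × EuclideanSpace ℝ (Fin m) => (d ∘ F q.1 ∘ c.symm) q.2) (t₀, c x) := by
      have h1 : ContMDiffAt (𝓘(ℝ, ℝ).prod (𝓡 m)) (𝓘(ℝ, ℝ).prod (𝓡 m)) ∞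
          (fun q : ℝ × EuclideanSpace ℝ (Fin m) => (q.1, c.symm q.2)) (t₀, c x) :=
        contMDiffAt_fst.prodMk (ContMDiffAt.comp (t₀, c x) hsymm contMDiffAt_snd)
      have h2 : ContMDiffAt (𝓡 m) (𝓡 m) ∞ d (F t₀ x) :=
        contMDiffAt_of_mem_maximalAtlas hd (hmaps hx)
      have h3 : ContMDiffAt (𝓘(ℝ, ℝ).prod (𝓡 m)) (𝓡 m) ∞
          (fun q : ℝ × EuclideanSpace ℝ (Fin m) => d (F q.1 (c.symm q.2))) (t₀, c x) := by
        refine ContMDiffAt.comp_of_eq (y := F t₀ x) h2 (ContMDiffAt.comp_of_eq (hs x) h1 ?_) ?_ <;>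
        simp [c.left_inv hxc]
      rw [← contMDiffAt_iff_contDiffAt, modelWithCornersSelf_prod, ← chartedSpaceSelf_prod]
      exact h3
    have hf : ContDiffAt ℝ ∞ (d ∘ f ∘ c.symm) (c x) := by
      rw [← contMDiffAt_iff_contDiffAt]
      have h2 : ContMDiffAt (𝓡 m) (𝓡 m) ∞ d (f x) :=
        contMDiffAt_of_mem_maximalAtlas hd (hfL hx)
      refine ContMDiffAt.comp_of_eq (y := f x) h2 (f.contMDiff.contMDiffAt.comp _ hsymm) ?_
      simp [c.left_inv hxc]
    have hcp : ContinuousAt (fun p : ℝ × M => (p.1, c p.2)) (t₀, x) :=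
      continuousAt_fst.prodMk (ContinuousAt.comp (f := Prod.snd) hcx continuousAt_snd)
    have e2 : ∀ᶠ p : ℝ × M in nhds (t₀, x), ∀ j ∈ Iic r,
        ‖iteratedFDeriv ℝ j (d ∘ F p.1 ∘ c.symm) (c p.2) -
          iteratedFDeriv ℝ j (d ∘ f ∘ c.symm) (c p.2)‖ < ε := by
      rw [Filter.eventually_all_finite (finite_Iic r)]
      intro j hj
      have a1 :=
        (contDiffAt_iteratedFDeriv_of_family (G := fun t => d ∘ F t ∘ c.symm) hG j).continuousAt
      have hf' : ContDiffAt ℝ ∞ (fun q : ℝ × EuclideanSpace ℝ (Fin m) =>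
          (fun _ : ℝ => d ∘ f ∘ c.symm) q.1 q.2) (t₀, c x) :=
        ContDiffAt.comp (f := Prod.snd) (t₀, c x) hf contDiffAt_snd
      have a2 :=
        (contDiffAt_iteratedFDeriv_of_family (G := fun _ : ℝ => d ∘ f ∘ c.symm) hf' j).continuousAt
      have a3 := ContinuousAt.comp (f := fun p : ℝ × M => (p.1, c p.2)) (x := (t₀, x))
        (a1.sub a2).norm hcp
      exact a3.eventually (Iio_mem_nhds (hclose x hx j hj))
    filter_upwards [e1, e2] with p h1 h2 using ⟨h1, h2⟩
  filter_upwards [key] with t ht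
  exact ⟨fun x hx => (ht x hx).1, fun x hx => (ht x hx).2⟩

/-- A smooth family of diffeomorphisms supported in a common compact set is continuous for the
`C^∞` topology. -/
theorem continuousAt_of_family (F : ℝ → DiffC m M) {K : Set M} (hK : IsCompact K)
    (hF : ∀ t, ∀ x ∉ K, (F t).toDiff x = x) (t₀ : ℝ)
    (hs : ∀ x, ContMDiffAt (𝓘(ℝ, ℝ).prod (𝓡 m)) (𝓡 m) ∞
      (fun p : ℝ × M => (F p.1).toDiff p.2) (t₀, x)) :
    ContinuousAt F t₀ := by
  let K' : Compacts M := ⟨K, hK⟩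
  let F' : ℝ → DiffIn (m := m) K' := fun t => ⟨F t, hF t⟩
  have h1 : ContinuousAt F' t₀ := by
    let := weakTopology m M
    rw [ContinuousAt, nhds_induced, Filter.tendsto_comap_iff]
    exact continuousAt_weakTopology_of_family (fun t => (F t).toDiff) t₀ hs
  have h2 : Continuous (fun φ : DiffIn (m := m) K' => φ.1) := by
    rw [continuous_iff_coinduced_le]
    exact le_iSup (fun K : Compacts M =>
      coinduced (fun φ : DiffIn (m := m) K => φ.1) inferInstance) K'
  exact h2.continuousAt.comp h1

end Topology

/-! ### Perturbations of the identity of a Banach space -/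

section Perturbation

variable {E : Type*} [NormedAddCommGroup E] [NormedSpace ℝ E] [CompleteSpace E]

/-- A smooth perturbation of the identity by a contraction is a smooth diffeomorphism. -/
theorem exists_homeomorph_add (u : E → E) (hu : ContDiff ℝ ∞ u) {k : NNReal} (hk : k < 1)
    (hl : LipschitzWith k u) :
    ∃ h : E ≃ₜ E, (∀ x, h x = x + u x) ∧ ContDiff ℝ ∞ h.symm := by
  have happ : ApproximatesLinearOn (fun x => x + u x)
      ((ContinuousLinearEquiv.refl ℝ E : E ≃L[ℝ] E) : E →L[ℝ] E) univ k := by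
    intro x _ y _
    have := hl.dist_le_mul x y
    rw [dist_eq_norm, dist_eq_norm] at this
    refine le_trans (le_of_eq ?_) this
    congr 1
    simp only [ContinuousLinearEquiv.coe_refl, ContinuousLinearMap.coe_id', id]
    abel
  have hc : Subsingleton E ∨ k < ‖(((ContinuousLinearEquiv.refl ℝ E).symm : E ≃L[ℝ] E) :
      E →L[ℝ] E)‖₊⁻¹ := by
    rcases subsingleton_or_nontrivial E with h | h
    · exact Or.inl h
    · right
      have : ‖(((ContinuousLinearEquiv.refl ℝ E).symm : E ≃L[ℝ] E) : E →L[ℝ] E)‖₊ = 1 :=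
        ContinuousLinearMap.nnnorm_id
      rw [this]; simpa using hk
  let h : E ≃ₜ E := happ.toHomeomorph (fun x => x + u x) hc
  have hh : ∀ x, h x = x + u x := fun x => rfl
  refine ⟨h, hh, ?_⟩
  have hn : ∀ x, ‖-fderiv ℝ u x‖ < 1 := fun x => by
    rw [norm_neg]
    exact (norm_fderiv_le_of_lipschitz ℝ hl).trans_lt (by exact_mod_cast hk)
  refine h.contDiff_symm (f₀' := fun x => ContinuousLinearEquiv.unitsEquiv ℝ E
    (Units.oneSub (-fderiv ℝ u x) (hn x))) (fun x => ?_) ?_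
  · have h1 : HasFDerivAt (fun x => x + u x) (ContinuousLinearMap.id ℝ E + fderiv ℝ u x) x :=
      (hasFDerivAt_id x).add (hu.differentiable (by simp) x).hasFDerivAt
    have h2 : ((ContinuousLinearEquiv.unitsEquiv ℝ E (Units.oneSub (-fderiv ℝ u x) (hn x)) :
        E ≃L[ℝ] E) : E →L[ℝ] E) = ContinuousLinearMap.id ℝ E + fderiv ℝ u x := by
      ext y
      simp [ContinuousLinearEquiv.unitsEquiv_apply]
    rw [h2]; exact h1
  · exact contDiff_id.add hu

omit [NormedSpace ℝ E] [CompleteSpace E] in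
theorem injective_add_of_lipschitzWith {u : E → E} {k : NNReal} (hk : k < 1)
    (hl : LipschitzWith k u) : Function.Injective (fun x => x + u x) := by
  intro x y hxy
  have h1 : x - y = u y - u x := by
    rw [sub_eq_sub_iff_add_eq_add, add_comm (u y)]; exact hxy
  have h2 : dist x y ≤ k * dist x y := by
    have := hl.dist_le_mul y x
    rwa [dist_eq_norm (u y), ← h1, ← dist_eq_norm, dist_comm y x] at this
  have h3 : (k : ℝ) < 1 := by exact_mod_cast hk
  exact dist_le_zero.mp (by nlinarith [dist_nonneg (x := x) (y := y)])

end Perturbation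

/-! ### Diffeomorphisms supported in a chart -/

section Extension

variable {m : ℕ} {M : Type*} [TopologicalSpace M]

open Classical in
/-- The map of the manifold which is `h` in the chart `c`, and the identity outside its domain. -/
noncomputable def chartExt (c : OpenPartialHomeomorph M (EuclideanSpace ℝ (Fin m)))
    (h : EuclideanSpace ℝ (Fin m) → EuclideanSpace ℝ (Fin m)) (x : M) : M :=
  if x ∈ c.source then c.symm (h (c x)) else x

variable {c : OpenPartialHomeomorph M (EuclideanSpace ℝ (Fin m))}
  {h h' : EuclideanSpace ℝ (Fin m) → EuclideanSpace ℝ (Fin m)}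
  {K : Set (EuclideanSpace ℝ (Fin m))}

theorem chartExt_of_mem {x : M} (hx : x ∈ c.source) : chartExt c h x = c.symm (h (c x)) :=
  if_pos hx

theorem chartExt_of_notMem {x : M} (hx : x ∉ c.source) : chartExt c h x = x :=
  if_neg hx

theorem chartExt_symm {y : EuclideanSpace ℝ (Fin m)} (hy : y ∈ c.target) :
    chartExt c h (c.symm y) = c.symm (h y) := by
  rw [chartExt_of_mem (c.map_target hy), c.right_inv hy]

theorem chartExt_eq_self (hh : ∀ y ∉ K, h y = y) {x : M} (hx : x ∉ c.symm '' K) :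
    chartExt c h x = x := by
  by_cases hxs : x ∈ c.source
  · rw [chartExt_of_mem hxs, hh _ (fun hK => hx ⟨_, hK, c.left_inv hxs⟩), c.left_inv hxs]
  · exact chartExt_of_notMem hxs

theorem chartExt_comp (hm : MapsTo h c.target c.target) (x : M) :
    chartExt c h' (chartExt c h x) = chartExt c (h' ∘ h) x := by
  by_cases hxs : x ∈ c.source
  · rw [chartExt_of_mem hxs, chartExt_symm (hm (c.map_source hxs)), chartExt_of_mem hxs]; rfl
  · simp [chartExt_of_notMem hxs]

theorem chartExt_id (x : M) : chartExt c (fun y => y) x = x := by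
  by_cases hxs : x ∈ c.source
  · rw [chartExt_of_mem hxs, c.left_inv hxs]
  · exact chartExt_of_notMem hxs

/-- A bijection of the model space which is the identity off a subset `K` of `U` preserves `U`. -/
theorem mapsTo_of_injective_of_eq_self {α : Type*} {f : α → α} {K U : Set α}
    (hf : f.Injective) (hfK : ∀ y ∉ K, f y = y) (hKU : K ⊆ U) : MapsTo f U U := by
  intro y hy
  by_contra hn
  have h1 : f (f y) = f y := hfK _ fun h => hn (hKU h)
  rw [hf h1] at hn
  exact hn hy

theorem isCompact_symm_image [T2Space M] (hK : IsCompact K) (hKt : K ⊆ c.target) :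
    IsCompact (c.symm '' K) :=
  hK.image_of_continuousOn (c.continuousOn_symm.mono hKt)

variable [ChartedSpace (EuclideanSpace ℝ (Fin m)) M]

/-- A smooth family of perturbations of the identity, supported in a fixed compact set of the
target of a chart, extends to a jointly smooth family of maps of the manifold. -/
theorem contMDiffAt_chartExt_family [T2Space M] (hc : c ∈ IsManifold.maximalAtlas (𝓡 m) ∞ M)
    (hK : IsCompact K) (hKt : K ⊆ c.target)
    {u : ℝ → EuclideanSpace ℝ (Fin m) → EuclideanSpace ℝ (Fin m)}
    (hu : ContDiff ℝ ∞ (fun p : ℝ × EuclideanSpace ℝ (Fin m) => u p.1 p.2))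
    (huK : ∀ t, ∀ y ∉ K, u t y = 0) {t₀ : ℝ}
    (hmaps : MapsTo (fun y => y + u t₀ y) c.target c.target) (x : M) :
    ContMDiffAt (𝓘(ℝ, ℝ).prod (𝓡 m)) (𝓡 m) ∞
      (fun p : ℝ × M => chartExt c (fun y => y + u p.1 y) p.2) (t₀, x) := by
  by_cases hx : x ∈ c.source
  · have hcx : ContMDiffAt (𝓡 m) (𝓡 m) ∞ c x := contMDiffAt_of_mem_maximalAtlas hc hx
    have h1 : ContMDiffAt (𝓘(ℝ, ℝ).prod (𝓡 m)) (𝓘(ℝ, ℝ).prod (𝓡 m)) ∞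
        (fun p : ℝ × M => (p.1, c p.2)) (t₀, x) :=
      contMDiffAt_fst.prodMk (ContMDiffAt.comp (t₀, x) hcx contMDiffAt_snd)
    have h2 : ContMDiff (𝓘(ℝ, ℝ).prod (𝓡 m)) (𝓡 m) ∞
        (fun p : ℝ × EuclideanSpace ℝ (Fin m) => p.2 + u p.1 p.2) := by
      have : ContDiff ℝ ∞ (fun p : ℝ × EuclideanSpace ℝ (Fin m) => p.2 + u p.1 p.2) :=
        contDiff_snd.add hu
      rw [← contMDiff_iff_contDiff, modelWithCornersSelf_prod, ← chartedSpaceSelf_prod] at this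
      exact this
    have h3 : ContMDiffAt (𝓡 m) (𝓡 m) ∞ c.symm (c x + u t₀ (c x)) :=
      contMDiffAt_symm_of_mem_maximalAtlas hc (hmaps (c.map_source hx))
    have h4 : ContMDiffAt (𝓘(ℝ, ℝ).prod (𝓡 m)) (𝓡 m) ∞
        (fun p : ℝ × M => c.symm (c p.2 + u p.1 (c p.2))) (t₀, x) := by
      have h5 := ContMDiffAt.comp (t₀, x) h2.contMDiffAt h1
      exact ContMDiffAt.comp (t₀, x) h3 h5
    refine h4.congr_of_eventuallyEq ?_
    have : ∀ᶠ p : ℝ × M in nhds (t₀, x), p.2 ∈ c.source :=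
      continuousAt_snd.eventually (c.open_source.mem_nhds hx)
    filter_upwards [this] with p hp using chartExt_of_mem hp
  · have hcl : IsClosed (c.symm '' K) := (isCompact_symm_image hK hKt).isClosed
    have hxK : x ∉ c.symm '' K := by
      rintro ⟨y, hy, rfl⟩
      exact hx (c.map_target (hKt hy))
    refine (contMDiffAt_snd (I := 𝓘(ℝ, ℝ)) (J := 𝓡 m)).congr_of_eventuallyEq ?_
    have : ∀ᶠ p : ℝ × M in nhds (t₀, x), p.2 ∈ (c.symm '' K)ᶜ :=
      continuousAt_snd.eventually (hcl.isOpen_compl.mem_nhds hxK)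
    filter_upwards [this] with p hp
    exact chartExt_eq_self (K := K) (fun y hy => by simp [huK _ y hy]) hp

theorem contMDiff_chartExt [T2Space M] (hc : c ∈ IsManifold.maximalAtlas (𝓡 m) ∞ M)
    (hK : IsCompact K) (hKt : K ⊆ c.target) (hh : ContDiff ℝ ∞ h) (hhK : ∀ y ∉ K, h y = y)
    (hi : h.Injective) : ContMDiff (𝓡 m) (𝓡 m) ∞ (chartExt c h : M → M) := by
  intro x
  have hm := mapsTo_of_injective_of_eq_self hi hhK hKt
  have := contMDiffAt_chartExt_family (M := M) hc hK hKt (u := fun _ y => h y - y) (t₀ := 0)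
    ((hh.comp contDiff_snd).sub contDiff_snd) (fun _ y hy => by simp [hhK y hy])
    (by simpa using hm) x
  simp only [add_sub_cancel] at this
  exact ContMDiffAt.comp (f := fun x : M => ((0 : ℝ), x)) x this
    (contMDiffAt_const.prodMk contMDiffAt_id)

/-- A contracting perturbation of the identity supported in a chart extends to a compactly
supported diffeomorphism of the manifold. -/
theorem exists_diffC_eq_chartExt [T2Space M] (hc : c ∈ IsManifold.maximalAtlas (𝓡 m) ∞ M)
    (hK : IsCompact K) (hKt : K ⊆ c.target)
    {u : EuclideanSpace ℝ (Fin m) → EuclideanSpace ℝ (Fin m)} (hu : ContDiff ℝ ∞ u)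
    (huK : ∀ y ∉ K, u y = 0) {k : NNReal} (hk : k < 1) (hl : LipschitzWith k u) :
    ∃ φ : DiffC m M, ∀ x, φ.toDiff x = chartExt c (fun y => y + u y) x := by
  obtain ⟨H, hH, hHs⟩ := exists_homeomorph_add u hu hk hl
  have hH' : (fun y => y + u y) = H := by funext y; rw [hH]
  have hHK : ∀ y ∉ K, H y = y := fun y hy => by simp [hH, huK y hy]
  have hHsK : ∀ y ∉ K, H.symm y = y := fun y hy => by
    rw [Homeomorph.symm_apply_eq, hHK y hy]
  have hHc : ContDiff ℝ ∞ H := by rw [← hH']; exact contDiff_id.add hu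
  have hm := mapsTo_of_injective_of_eq_self H.injective hHK hKt
  have hms := mapsTo_of_injective_of_eq_self H.symm.injective hHsK hKt
  let Φ : Diff m M :=
    { toFun := chartExt c H
      invFun := chartExt c H.symm
      left_inv := fun x => by
        rw [chartExt_comp hm]
        have : (H.symm ∘ H : _ → _) = fun y => y := by funext y; simp
        rw [this, chartExt_id]
      right_inv := fun x => by
        rw [chartExt_comp hms]
        have : (H ∘ H.symm : _ → _) = fun y => y := by funext y; simp
        rw [this, chartExt_id]
      contMDiff_toFun := contMDiff_chartExt hc hK hKt hHc hHK H.injective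
      contMDiff_invFun := contMDiff_chartExt hc hK hKt hHs hHsK H.symm.injective }
  have hcomp : IsCompact (c.symm '' K) := isCompact_symm_image hK hKt
  refine ⟨⟨Φ, hcomp.of_isClosed_subset isClosed_closure
    (closure_minimal (fun x hx => ?_) hcomp.isClosed)⟩, fun x => ?_⟩
  · by_contra hn
    exact hx (chartExt_eq_self hHK hn)
  · rw [hH']; rfl

/-- The extension of a contracting perturbation of the identity is isotopic to the identity, by
scaling the perturbation. -/
theorem mem_diffC0_of_eq_chartExt [T2Space M] (hc : c ∈ IsManifold.maximalAtlas (𝓡 m) ∞ M)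
    (hK : IsCompact K) (hKt : K ⊆ c.target)
    {u : EuclideanSpace ℝ (Fin m) → EuclideanSpace ℝ (Fin m)} (hu : ContDiff ℝ ∞ u)
    (huK : ∀ y ∉ K, u y = 0) {k : NNReal} (hk : k < 1) (hl : LipschitzWith k u)
    {φ : DiffC m M} (hφ : ∀ x, φ.toDiff x = chartExt c (fun y => y + u y) x) :
    φ ∈ DiffC0 m M := by
  have hlt : ∀ t ∈ Icc (0 : ℝ) 1, LipschitzWith k (fun y => t • u y) := fun t ht =>
    LipschitzWith.of_dist_le_mul fun x y => by
      rw [dist_smul₀, Real.norm_of_nonneg ht.1]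
      exact (mul_le_of_le_one_left dist_nonneg ht.2).trans (hl.dist_le_mul x y)
  have hut : ContDiff ℝ ∞ (fun p : ℝ × EuclideanSpace ℝ (Fin m) => p.1 • u p.2) :=
    contDiff_fst.smul (hu.comp contDiff_snd)
  have hutK : ∀ t : ℝ, ∀ y ∉ K, t • u y = 0 := fun t y hy => by simp [huK y hy]
  have hex : ∀ t : ℝ, ∃ Φ : Diff m M, t ∈ Icc (0 : ℝ) 1 →
      ∀ x, Φ x = chartExt c (fun y => y + t • u y) x := fun t => by
    by_cases ht : t ∈ Icc (0 : ℝ) 1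
    · obtain ⟨Φ, hΦ⟩ := exists_diffC_eq_chartExt (M := M) hc hK hKt (hu.const_smul t) (hutK t) hk
        (hlt t ht)
      exact ⟨Φ.toDiff, fun _ => hΦ⟩
    · exact ⟨Diffeomorph.refl _ _ _, fun h => absurd h ht⟩
  choose Φ hΦ using hex
  have hcomp : IsCompact (c.symm '' K) := isCompact_symm_image hK hKt
  refine ⟨Φ, ?_, fun x => ?_, fun x => ?_, c.symm '' K, hcomp, fun t ht => ?_⟩
  · rintro ⟨t, x⟩ ⟨ht, -⟩
    have hm : MapsTo (fun y => y + t • u y) c.target c.target :=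
      mapsTo_of_injective_of_eq_self (K := K) (injective_add_of_lipschitzWith hk (hlt t ht))
        (fun y hy => by simp [huK y hy]) hKt
    refine (contMDiffAt_chartExt_family hc hK hKt hut hutK hm x).contMDiffWithinAt.congr
      (fun p hp => hΦ _ hp.1 _) (hΦ _ ht _)
  · rw [hΦ 0 (by simp)]; simp [chartExt_id]
  · rw [hΦ 1 (by simp), hφ]; simp
  · refine closure_minimal (fun x hx => ?_) hcomp.isClosed
    by_contra hn
    exact hx ((hΦ t ht x).trans (chartExt_eq_self (fun y hy => by simp [huK y hy]) hn))

/-- The bound on the derivative of a smooth family, supported in a fixed compact set, is an open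
condition on the parameter. -/
theorem eventually_norm_fderiv_lt_of_family {E : Type*} [NormedAddCommGroup E] [NormedSpace ℝ E]
    {K : Set E} (hK : IsCompact K) {u : ℝ → E → E}
    (hu : ContDiff ℝ ∞ (fun p : ℝ × E => u p.1 p.2)) (huK : ∀ t, ∀ y ∉ K, u t y = 0) {t₀ : ℝ}
    {k : NNReal} (hk : ∀ y, ‖fderiv ℝ (u t₀) y‖ < k) :
    ∀ᶠ t in nhds t₀, (∀ y, ‖fderiv ℝ (u t) y‖ < k) := by
  have hd : Continuous (fun p : ℝ × E => fderiv ℝ (u p.1) p.2) := by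
    have : ContDiff ℝ 0 (fun p : ℝ × E => fderiv ℝ (u p.1) p.2) := by
      have h : ContDiff ℝ ∞ (Function.uncurry fun p : ℝ × E => u p.1) :=
        hu.comp (f := fun r : (ℝ × E) × E => (r.1.1, r.2))
          ((contDiff_fst.fst).prodMk contDiff_snd)
      exact h.fderiv contDiff_snd (by simp)
    exact this.continuous
  have h1 : ∀ᶠ t in nhds t₀, ∀ y ∈ K, ‖fderiv ℝ (u t) y‖ < k :=
    hK.eventually_forall_of_forall_eventually fun y _ =>
      (hd.norm.continuousAt (x := (t₀, y))).eventually (Iio_mem_nhds (hk y))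
  filter_upwards [h1] with t ht y
  by_cases hy : y ∈ K
  · exact ht y hy
  · have : u t =ᶠ[nhds y] fun _ => 0 := by
      filter_upwards [hK.isClosed.isOpen_compl.mem_nhds hy] with z hz using huK t z hz
    rw [this.fderiv_eq]
    simpa using (norm_nonneg _).trans_lt (hk y)

/-- Let `u` be a smooth family of displacements supported in a compact set of a chart, such that
`u t₀` is a contraction. If the extension of `id + u t₀` belongs to an
open set, so does the extension of `id + u t` for `t` close to `t₀`. -/
theorem eventually_exists_mem_of_family [T2Space M]
    (hc : c ∈ IsManifold.maximalAtlas (𝓡 m) ∞ M) (hK : IsCompact K) (hKt : K ⊆ c.target)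
    {u : ℝ → EuclideanSpace ℝ (Fin m) → EuclideanSpace ℝ (Fin m)}
    (hu : ContDiff ℝ ∞ (fun p : ℝ × EuclideanSpace ℝ (Fin m) => u p.1 p.2))
    (huK : ∀ t, ∀ y ∉ K, u t y = 0) {t₀ : ℝ} (hk : ∀ y, ‖fderiv ℝ (u t₀) y‖ < (2⁻¹ : NNReal))
    {W : Set (DiffC0 m M)} (hW : IsOpen W) {φ₀ : DiffC0 m M} (hφ₀ : φ₀ ∈ W)
    (hφ₀' : ∀ x, φ₀.1.toDiff x = chartExt c (fun y => y + u t₀ y) x) :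
    ∀ᶠ t in nhds t₀, (∀ y, ‖fderiv ℝ (u t) y‖ < (2⁻¹ : NNReal)) ∧
      MapsTo (fun y => y + u t y) c.target c.target ∧
      ∃ φ ∈ W, ∀ x, φ.1.toDiff x = chartExt c (fun y => y + u t y) x := by
  have hk2 : (2⁻¹ : NNReal) < 1 := by
    rw [← NNReal.coe_lt_coe]; norm_num
  have hut : ∀ t, ContDiff ℝ ∞ (u t) := fun t => hu.comp (contDiff_const.prodMk contDiff_id)
  have hlip : ∀ t, (∀ y, ‖fderiv ℝ (u t) y‖ < (2⁻¹ : NNReal)) → LipschitzWith 2⁻¹ (u t) :=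
    fun t ht => lipschitzWith_of_nnnorm_fderiv_le ((hut t).differentiable (by simp))
      fun y => by exact_mod_cast (ht y).le
  have hev := eventually_norm_fderiv_lt_of_family hK hu huK hk
  have hex : ∀ t : ℝ, ∃ Φ : DiffC m M, (∀ x ∉ c.symm '' K, Φ.toDiff x = x) ∧
      ((∀ y, ‖fderiv ℝ (u t) y‖ < (2⁻¹ : NNReal)) →
        ∀ x, Φ.toDiff x = chartExt c (fun y => y + u t y) x) := fun t => by
    by_cases ht : ∀ y, ‖fderiv ℝ (u t) y‖ < (2⁻¹ : NNReal)
    · obtain ⟨Φ, hΦ⟩ := exists_diffC_eq_chartExt (M := M) hc hK hKt (hut t) (huK t) hk2 (hlip t ht)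
      exact ⟨Φ, fun x hx => (hΦ x).trans (chartExt_eq_self (fun y hy => by simp [huK t y hy]) hx),
        fun _ => hΦ⟩
    · exact ⟨DiffC.id, fun _ _ => rfl, fun h => absurd h ht⟩
  choose Φ hΦK hΦ using hex
  have hm : MapsTo (fun y => y + u t₀ y) c.target c.target :=
    mapsTo_of_injective_of_eq_self (K := K) (injective_add_of_lipschitzWith hk2 (hlip t₀ hk))
      (fun y hy => by simp [huK t₀ y hy]) hKt
  have hcont : ContinuousAt Φ t₀ := by
    refine continuousAt_of_family Φ (isCompact_symm_image hK hKt) hΦK t₀ fun x => ?_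
    refine (contMDiffAt_chartExt_family hc hK hKt hu huK hm x).congr_of_eventuallyEq ?_
    filter_upwards [continuousAt_fst.eventually hev] with p hp using hΦ _ hp _
  obtain ⟨W', hW', rfl⟩ := isOpen_induced_iff.mp hW
  have h0 : Φ t₀ = φ₀.1 := DiffC.ext (Diffeomorph.ext fun x => by rw [hΦ t₀ hk, hφ₀'])
  have hmem : Φ t₀ ∈ W' := by rw [h0]; exact hφ₀
  filter_upwards [hev, hcont.eventually (hW'.mem_nhds hmem)] with t ht htW
  exact ⟨ht, mapsTo_of_injective_of_eq_self (K := K)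
    (injective_add_of_lipschitzWith hk2 (hlip t ht)) (fun y hy => by simp [huK t y hy]) hKt,
    ⟨Φ t, mem_diffC0_of_eq_chartExt hc hK hKt (hut t) (huK t) hk2 (hlip t ht) (hΦ t ht)⟩,
    htW, hΦ t ht⟩

/-- Around every point there is a chart of the smooth structure whose target contains a given
ball. -/
theorem exists_chart_closedBall_subset [IsManifold (𝓡 m) ∞ M] (x₀ : M) (R : ℝ) :
    ∃ c : OpenPartialHomeomorph M (EuclideanSpace ℝ (Fin m)),
      c ∈ IsManifold.maximalAtlas (𝓡 m) ∞ M ∧ Metric.closedBall 0 R ⊆ c.target := by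
  let c₀ := chartAt (EuclideanSpace ℝ (Fin m)) x₀
  have hc₀ : c₀ ∈ IsManifold.maximalAtlas (𝓡 m) ∞ M := IsManifold.chart_mem_maximalAtlas x₀
  obtain ⟨ρ, hρ, hball⟩ := Metric.isOpen_iff.mp c₀.open_target (c₀ x₀)
    (c₀.map_source (mem_chart_source _ x₀))
  let s : ℝ := ρ / (|R| + 1)
  have hR : 0 < |R| + 1 := by positivity
  have hs : 0 < s := div_pos hρ hR
  let a : EuclideanSpace ℝ (Fin m) ≃ₜ EuclideanSpace ℝ (Fin m) :=
    (Homeomorph.smulOfNeZero s hs.ne').trans (Homeomorph.addRight (c₀ x₀))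
  have ha : ∀ y, a y = s • y + c₀ x₀ := fun y => rfl
  have has : ∀ y, a.symm y = s⁻¹ • (y - c₀ x₀) := fun y => by
    rw [Homeomorph.symm_apply_eq, ha, smul_smul, mul_inv_cancel₀ hs.ne', one_smul, sub_add_cancel]
  have hac : ContDiff ℝ ∞ a := by
    rw [show (a : _ → _) = _ from funext ha]; exact (contDiff_id.const_smul s).add contDiff_const
  have hasc : ContDiff ℝ ∞ a.symm := by
    rw [show (a.symm : _ → _) = _ from funext has]
    exact (contDiff_id.sub contDiff_const).const_smul _
  refine ⟨c₀.transHomeomorph a.symm, ?_, fun y hy => ?_⟩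
  · refine OpenPartialHomeomorph.mem_maximalAtlas_of_contMDiffOn (I := 𝓡 m) _ ?_ ?_
    · exact hasc.contMDiff.comp_contMDiffOn (contMDiffOn_of_mem_maximalAtlas hc₀)
    · exact (contMDiffOn_symm_of_mem_maximalAtlas hc₀).comp (hac.contMDiff.contMDiffOn)
        (fun y hy => hy)
  · change a y ∈ c₀.target
    apply hball
    rw [ha, Metric.mem_ball, dist_eq_norm, add_sub_cancel_right, norm_smul,
      Real.norm_of_nonneg hs.le]
    have : ‖y‖ < |R| + 1 := by
      have := mem_closedBall_zero_iff.mp hy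
      linarith [le_abs_self R]
    calc s * ‖y‖ < s * (|R| + 1) := by gcongr
      _ = ρ := div_mul_cancel₀ _ hR.ne'

end Extension

/-! ### Cycles of even length and square roots -/

section Cycle

/-- Milnor's obstruction. If the points of even minimal period `n` of an injective map `f` form
exactly one cycle, then `f` has no square root: a square root maps this cycle to itself, where it
commutes with `f`, hence acts as some `f^j`, and `2 j ≡ 1` modulo the even number `n` is
impossible. -/
theorem not_exists_sqrt_of_unique_cycle {X : Type*} {f : X → X} {n : ℕ} (hpos : 0 < n)
    (hn : Even n) {p : X}
    (hp : Function.minimalPeriod f p = n)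
    (hu : ∀ x, Function.minimalPeriod f x = n → ∃ j, x = f^[j] p)
    (hf : f.Injective) {ψ : X → X} (hψ : ∀ x, ψ (ψ x) = f x) : False := by
  have hi : ψ.Injective := fun x y hxy => hf (by rw [← hψ, ← hψ, hxy])
  have hcomm : Function.Commute ψ f := fun x => by rw [← hψ, ← hψ]
  have hper : Function.minimalPeriod f (ψ p) = n := by
    rw [← hp, Function.minimalPeriod_eq_minimalPeriod_iff]
    intro k
    rw [Function.IsPeriodicPt, Function.IsPeriodicPt, Function.IsFixedPt, Function.IsFixedPt,
      ← hcomm.iterate_right k p, hi.eq_iff]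
  obtain ⟨j, hj⟩ := hu _ hper
  have h2 : f^[j + j] p = f^[1] p := by
    rw [Function.iterate_add_apply, ← hj, ← hcomm.iterate_right j p, ← hj, hψ]; rfl
  have h3 : f^[(j + j) % n] p = f^[1 % n] p := by
    rw [← hp, Function.iterate_mod_minimalPeriod_eq, Function.iterate_mod_minimalPeriod_eq, h2]
  have h4 : (j + j) % n = 1 % n :=
    Function.iterate_injOn_Iio_minimalPeriod (by rw [hp]; exact Nat.mod_lt _ hpos)
      (by rw [hp]; exact Nat.mod_lt _ hpos) h3
  have h5 : (j + j) % 2 = 1 % 2 := Nat.ModEq.of_dvd (even_iff_two_dvd.mp hn) h4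
  omega

end Cycle

/-! ### A diffeomorphism with a single cycle of a given length -/

section Model

variable {E : Type*} [NormedAddCommGroup E] [InnerProductSpace ℝ E]
  (Z : E →L[ℝ] ℂ) (ι : ℂ →L[ℝ] E)

/-- The squared defect of a point from the unit circle `ι (S¹)`, where `ι` is an embedding of
`ℂ` with left inverse `Z`. It is the Lyapunov function of the model diffeomorphism. -/
noncomputable def circleDefect (x : E) : ℝ :=
  (‖Z x‖ ^ 2 - 1) ^ 2 + ‖x - ι (Z x)‖ ^ 2

/-- A cutoff function which is positive exactly where `circleDefect` is less than `1 / 4`, and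
which is `1` on the circle. -/
noncomputable def circleCutoff (x : E) : ℝ :=
  Real.smoothTransition (1 - 4 * circleDefect Z ι x)

/-- The displacement of the model diffeomorphism. Cut off near the unit circle, this
diffeomorphism rotates by the angle `a + ε (1 - cos (n θ))` and contracts towards the circle at
rate `ε`. -/
noncomputable def circleField (n : ℕ) (a ε : ℝ) (x : E) : E :=
  ι (((1 - ε * circleCutoff Z ι x * (‖Z x‖ ^ 2 - 1) : ℝ) *
      Complex.exp ((circleCutoff Z ι x * (a + ε * (1 - (Z x ^ n).re)) : ℝ) * Complex.I) - 1) *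
      Z x) - (ε * circleCutoff Z ι x) • (x - ι (Z x))

/-- The model diffeomorphism. -/
noncomputable def circleMap (n : ℕ) (a ε : ℝ) (x : E) : E :=
  x + circleField Z ι n a ε x

theorem contDiff_circleDefect : ContDiff ℝ ∞ (circleDefect Z ι) := by
  unfold circleDefect
  have h1 : ContDiff ℝ ∞ (fun x => ‖Z x‖ ^ 2) := Z.contDiff.norm_sq ℝ
  have h2 : ContDiff ℝ ∞ (fun x => ‖x - ι (Z x)‖ ^ 2) :=
    (contDiff_id.sub (ι.contDiff.comp Z.contDiff)).norm_sq ℝ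
  exact ((h1.sub contDiff_const).pow 2).add h2

theorem contDiff_circleCutoff : ContDiff ℝ ∞ (circleCutoff Z ι) := by
  unfold circleCutoff
  exact Real.smoothTransition.contDiff.comp
    (contDiff_const.sub (contDiff_const.mul (contDiff_circleDefect Z ι)))

theorem contDiff_circleField (n : ℕ) :
    ContDiff ℝ ∞ (fun p : (ℝ × ℝ) × E => circleField Z ι n p.1.1 p.1.2 p.2) := by
  unfold circleField
  have hχ : ContDiff ℝ ∞ (fun p : (ℝ × ℝ) × E => circleCutoff Z ι p.2) :=
    (contDiff_circleCutoff Z ι).comp contDiff_snd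
  have hZ : ContDiff ℝ ∞ (fun p : (ℝ × ℝ) × E => Z p.2) := Z.contDiff.comp contDiff_snd
  have hN : ContDiff ℝ ∞ (fun p : (ℝ × ℝ) × E => ‖Z p.2‖ ^ 2) := hZ.norm_sq ℝ
  have hre : ContDiff ℝ ∞ (fun p : (ℝ × ℝ) × E => (Z p.2 ^ n).re) :=
    Complex.reCLM.contDiff.comp (hZ.pow n)
  have ha : ContDiff ℝ ∞ (fun p : (ℝ × ℝ) × E => p.1.1) := contDiff_fst.fst
  have hε : ContDiff ℝ ∞ (fun p : (ℝ × ℝ) × E => p.1.2) := contDiff_fst.snd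
  have hof : ContDiff ℝ ∞ (fun r : ℝ => (r : ℂ)) := Complex.ofRealCLM.contDiff
  refine ContDiff.sub (ι.contDiff.comp ?_) ((hε.mul hχ).smul
    (contDiff_snd.sub (ι.contDiff.comp hZ)))
  refine ContDiff.mul (ContDiff.sub (ContDiff.mul (hof.comp ?_) ?_) contDiff_const) hZ
  · exact contDiff_const.sub ((hε.mul hχ).mul (hN.sub contDiff_const))
  · exact ((hof.comp (hχ.mul (ha.add (hε.mul (contDiff_const.sub hre))))).mul
      contDiff_const).cexp

theorem circleCutoff_eq_zero {x : E} (hx : 1 / 4 ≤ circleDefect Z ι x) :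
    circleCutoff Z ι x = 0 :=
  Real.smoothTransition.zero_of_nonpos (by linarith)

theorem circleField_eq_zero {n : ℕ} {a ε : ℝ} {x : E} (hx : 1 / 4 ≤ circleDefect Z ι x) :
    circleField Z ι n a ε x = 0 := by
  simp [circleField, circleCutoff_eq_zero Z ι hx]

theorem circleField_zero (n : ℕ) (x : E) : circleField Z ι n 0 0 x = 0 := by
  simp [circleField]

theorem circleDefect_nonneg (x : E) : 0 ≤ circleDefect Z ι x := by
  unfold circleDefect; positivity

theorem norm_le_of_circleDefect_le {x : E} (hx : circleDefect Z ι x ≤ 1 / 4) :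
    ‖x‖ ≤ 1 + ‖ι‖ * 2 := by
  unfold circleDefect at hx
  have h1 : ‖x - ι (Z x)‖ ≤ 1 := by
    nlinarith [sq_nonneg (‖Z x‖ ^ 2 - 1), norm_nonneg (x - ι (Z x))]
  have h3 : ‖Z x‖ ^ 2 ≤ 2 := by nlinarith [sq_nonneg ‖x - ι (Z x)‖]
  have h2 : ‖Z x‖ ≤ 2 := by nlinarith [norm_nonneg (Z x)]
  calc ‖x‖ = ‖(x - ι (Z x)) + ι (Z x)‖ := by rw [sub_add_cancel]
    _ ≤ ‖x - ι (Z x)‖ + ‖ι (Z x)‖ := norm_add_le _ _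
    _ ≤ 1 + ‖ι‖ * 2 := add_le_add h1 ((ι.le_opNorm _).trans (by gcongr))

theorem isCompact_circleDefect_le [ProperSpace E] :
    IsCompact {x | circleDefect Z ι x ≤ 1 / 4} := by
  refine (isCompact_closedBall (0 : E) (1 + ‖ι‖ * 2)).of_isClosed_subset
    (isClosed_le (contDiff_circleDefect Z ι).continuous continuous_const) fun x hx => ?_
  exact mem_closedBall_zero_iff.mpr (norm_le_of_circleDefect_le Z ι hx)

variable {Z ι} (hZ : ∀ z, Z (ι z) = z)
include hZ

theorem apply_circleMap (n : ℕ) (a ε : ℝ) (x : E) :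
    Z (circleMap Z ι n a ε x) = ((1 - ε * circleCutoff Z ι x * (‖Z x‖ ^ 2 - 1) : ℝ) *
      Complex.exp ((circleCutoff Z ι x * (a + ε * (1 - (Z x ^ n).re)) : ℝ) * Complex.I)) *
      Z x := by
  simp only [circleMap, circleField, map_add, map_sub, map_smul, hZ, sub_self, smul_zero, sub_zero]
  ring

theorem circleMap_sub (n : ℕ) (a ε : ℝ) (x : E) :
    circleMap Z ι n a ε x - ι (Z (circleMap Z ι n a ε x)) =
      (1 - ε * circleCutoff Z ι x) • (x - ι (Z x)) := by
  rw [apply_circleMap hZ]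
  simp only [circleMap, circleField, sub_mul, one_mul, map_sub, sub_smul, one_smul]
  abel

theorem circleDefect_circleMap (n : ℕ) (a ε : ℝ) (x : E) :
    circleDefect Z ι (circleMap Z ι n a ε x) =
      ((1 - ε * circleCutoff Z ι x * (‖Z x‖ ^ 2 - 1)) ^ 2 * ‖Z x‖ ^ 2 - 1) ^ 2 +
        (1 - ε * circleCutoff Z ι x) ^ 2 * ‖x - ι (Z x)‖ ^ 2 := by
  rw [circleDefect, circleMap_sub hZ, apply_circleMap hZ, norm_mul, norm_mul,
    Complex.norm_exp_ofReal_mul_I, norm_smul, Complex.norm_real, mul_one, mul_pow, mul_pow,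
    Real.norm_eq_abs, sq_abs, Real.norm_eq_abs, sq_abs]

omit hZ in
/-- The radial part of the contraction: `s ↦ (1 + s) (1 - e s)² - 1` shrinks `s`. -/
theorem radial_sq_le {e s : ℝ} (he : 0 ≤ e) (he' : e ≤ 1 / 4) (hs : |s| < 1 / 2) :
    ((1 - e * s) ^ 2 * (1 + s) - 1) ^ 2 ≤ (1 - e / 2) * s ^ 2 := by
  obtain ⟨hs1, hs2⟩ := abs_lt.mp hs
  have hes : |e * s| ≤ 1 / 8 := by
    rw [abs_mul, abs_of_nonneg he]; nlinarith [abs_nonneg s]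
  obtain ⟨h1, h2⟩ := abs_le.mp hes
  have hid : (1 - e * s) ^ 2 * (1 + s) - 1 = s * (1 - e * ((1 + s) * (2 - e * s))) := by ring
  have hw1 : 1 / 2 ≤ (1 + s) * (2 - e * s) := by nlinarith
  have hw2 : (1 + s) * (2 - e * s) ≤ 4 := by nlinarith
  rw [hid, mul_pow, mul_comm]
  refine mul_le_mul_of_nonneg_right ?_ (sq_nonneg s)
  set w := (1 + s) * (2 - e * s)
  have h3 : 0 ≤ 1 - e * w := by nlinarith
  have h4 : 1 - e * w ≤ 1 - e / 2 := by nlinarith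
  have h5 : 1 - e * w ≤ 1 := by nlinarith
  nlinarith

/-- The circle defect does not increase; where the cutoff is positive, it decreases at a definite
rate. -/
theorem circleDefect_circleMap_le (n : ℕ) (a : ℝ) {ε : ℝ} (hε : 0 ≤ ε) (hε' : ε ≤ 1 / 4) (x : E) :
    circleDefect Z ι (circleMap Z ι n a ε x) ≤
      (1 - ε * circleCutoff Z ι x / 2) * circleDefect Z ι x := by
  rcases le_or_gt (1 / 4) (circleDefect Z ι x) with h | h
  · rw [circleMap, circleField_eq_zero Z ι h, circleCutoff_eq_zero Z ι h]; simp
  · rw [circleDefect_circleMap hZ]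
    have hχ0 : 0 ≤ circleCutoff Z ι x := Real.smoothTransition.nonneg _
    have hχ1 : circleCutoff Z ι x ≤ 1 := Real.smoothTransition.le_one _
    have he : 0 ≤ ε * circleCutoff Z ι x := mul_nonneg hε hχ0
    have he' : ε * circleCutoff Z ι x ≤ 1 / 4 := by nlinarith
    set e := ε * circleCutoff Z ι x
    unfold circleDefect at h ⊢
    have hs : |‖Z x‖ ^ 2 - 1| < 1 / 2 := by
      rw [abs_lt]
      constructor <;> nlinarith [sq_nonneg ‖x - ι (Z x)‖]
    have := radial_sq_le he he' hs
    rw [add_sub_cancel] at this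
    have h2 : (1 - e) ^ 2 * ‖x - ι (Z x)‖ ^ 2 ≤ (1 - e / 2) * ‖x - ι (Z x)‖ ^ 2 :=
      mul_le_mul_of_nonneg_right (by nlinarith) (sq_nonneg _)
    linarith

theorem circleMap_of_norm_eq_one (n : ℕ) (a ε : ℝ) {z : ℂ} (hz : ‖z‖ = 1) :
    circleMap Z ι n a ε (ι z) =
      ι (Complex.exp ((a + ε * (1 - (z ^ n).re) : ℝ) * Complex.I) * z) := by
  have hd : circleDefect Z ι (ι z) = 0 := by simp [circleDefect, hZ, hz]
  have hχ : circleCutoff Z ι (ι z) = 1 := Real.smoothTransition.one_of_one_le (by simp [hd])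
  simp [circleMap, circleField, hχ, hZ, hz, sub_mul]

/-- The lift to angles of the model diffeomorphism on the circle. -/
theorem iterate_circleMap_exp (n : ℕ) (a ε θ : ℝ) (j : ℕ) :
    (circleMap Z ι n a ε)^[j] (ι (Complex.exp (θ * Complex.I))) =
      ι (Complex.exp (((fun t : ℝ => t + a + ε * (1 - Real.cos (n * t)))^[j] θ : ℝ) *
        Complex.I)) := by
  induction j generalizing θ with
  | zero => rfl
  | succ j ih =>
    rw [Function.iterate_succ_apply, Function.iterate_succ_apply, ← ih,
      circleMap_of_norm_eq_one hZ _ _ _ (Complex.norm_exp_ofReal_mul_I θ), ← Complex.exp_add,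
      ← Complex.exp_nat_mul]
    congr 4
    have : ((n : ℂ) * (θ * Complex.I)) = ((n * θ : ℝ) : ℂ) * Complex.I := by push_cast; ring
    rw [this, Complex.exp_ofReal_mul_I_re]
    push_cast; ring

omit hZ in
theorem iterate_angle_mem (n : ℕ) (a : ℝ) {ε : ℝ} (hε : 0 ≤ ε) (θ : ℝ) (j : ℕ) :
    (fun t : ℝ => t + a + ε * (1 - Real.cos (n * t)))^[j] θ ∈
      Icc (θ + j * a) (θ + j * a + j * (2 * ε)) := by
  induction j generalizing θ with
  | zero => simp
  | succ j ih =>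
    rw [Function.iterate_succ_apply]
    obtain ⟨h1, h2⟩ := ih (θ + a + ε * (1 - Real.cos (n * θ)))
    have h3 := Real.cos_le_one (n * θ)
    have h4 := Real.neg_one_le_cos (n * θ)
    push_cast
    constructor <;> nlinarith

theorem iterate_circleMap_one {n : ℕ} (hn : n ≠ 0) (ε : ℝ) (j : ℕ) :
    (circleMap Z ι n (2 * Real.pi / n) ε)^[j] (ι 1) =
      ι (Complex.exp (2 * Real.pi * Complex.I / n) ^ j) := by
  have hprim := Complex.isPrimitiveRoot_exp n hn
  induction j with
  | zero => simp
  | succ j ih =>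
    rw [Function.iterate_succ_apply', ih, circleMap_of_norm_eq_one hZ]
    · rw [← pow_mul, mul_comm j n, pow_mul, hprim.pow_eq_one, one_pow, pow_succ']
      simp only [Complex.one_re, sub_self, mul_zero, add_zero]
      congr 3
      push_cast; ring
    · rw [norm_pow, hprim.norm'_eq_one hn, one_pow]

theorem minimalPeriod_circleMap_one {n : ℕ} (hn : n ≠ 0) (ε : ℝ) :
    Function.minimalPeriod (circleMap Z ι n (2 * Real.pi / n) ε) (ι 1) = n := by
  have hprim := Complex.isPrimitiveRoot_exp n hn
  have hinj : Function.Injective ι := Function.LeftInverse.injective (g := Z) hZ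
  have hiff : ∀ j, Function.IsPeriodicPt (circleMap Z ι n (2 * Real.pi / n) ε) j (ι 1) ↔ n ∣ j := by
    intro j
    rw [Function.IsPeriodicPt, Function.IsFixedPt, iterate_circleMap_one hZ hn, hinj.eq_iff,
      hprim.pow_eq_one_iff_dvd]
  exact Nat.dvd_antisymm ((hiff n).mpr dvd_rfl).minimalPeriod_dvd
    ((hiff _).mp (Function.isPeriodicPt_minimalPeriod _ _))

/-- The points of minimal period `n` of the model diffeomorphism form a single cycle. Off the
circle the circle defect decreases strictly; on the circle, each step turns by at least `2 π / n`,
so that a cycle of length `n` turns by exactly this angle at each step. -/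
theorem exists_eq_iterate_of_minimalPeriod_eq {n : ℕ} (hn : 2 ≤ n) {ε : ℝ} (hε : 0 < ε)
    (hε' : ε ≤ 1 / 4) (hεn : n * ε < 3) {x : E}
    (hx : Function.minimalPeriod (circleMap Z ι n (2 * Real.pi / n) ε) x = n) :
    ∃ j, x = (circleMap Z ι n (2 * Real.pi / n) ε)^[j] (ι 1) := by
  have hn0 : n ≠ 0 := by omega
  have hnR : (n : ℝ) ≠ 0 := by exact_mod_cast hn0
  set a := 2 * Real.pi / n with ha
  have hna : n * a = 2 * Real.pi := by rw [ha]; field_simp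
  set f := circleMap Z ι n a ε with hf
  have hper : f^[n] x = x := by
    have := Function.isPeriodicPt_minimalPeriod f x
    rwa [hx] at this
  have hmono : ∀ y, circleDefect Z ι (f y) ≤ circleDefect Z ι y := fun y => by
    have h1 := circleDefect_circleMap_le hZ n a hε.le hε' y
    have h2 : 0 ≤ ε * circleCutoff Z ι y / 2 * circleDefect Z ι y := by
      have := circleDefect_nonneg Z ι y
      have : 0 ≤ circleCutoff Z ι y := Real.smoothTransition.nonneg _
      positivity
    linarith
  have hmono' : ∀ j y, circleDefect Z ι (f^[j] y) ≤ circleDefect Z ι y := by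
    intro j
    induction j with
    | zero => exact fun y => le_rfl
    | succ j ih => exact fun y => (ih (f y)).trans (hmono y)
  have hlt : circleDefect Z ι x < 1 / 4 := by
    by_contra hge
    have h1 : f x = x := by
      rw [hf, circleMap, circleField_eq_zero Z ι (not_lt.mp hge), add_zero]
    have := (Function.minimalPeriod_eq_one_iff_isFixedPt).mpr h1
    omega
  have hzero : circleDefect Z ι x = 0 := by
    have h1 : circleDefect Z ι x ≤ circleDefect Z ι (f x) := by
      obtain ⟨k, rfl⟩ := Nat.exists_eq_add_of_le' (show 1 ≤ n by omega)
      have := hmono' k (f x)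
      rwa [← Function.iterate_succ_apply, hper] at this
    have h2 := h1.trans (circleDefect_circleMap_le hZ n a hε.le hε' x)
    have h3 : 0 < circleCutoff Z ι x := Real.smoothTransition.pos_of_pos (by linarith)
    have h4 := mul_pos hε h3
    nlinarith [circleDefect_nonneg Z ι x]
  have hxι : x = ι (Z x) := by
    have : ‖x - ι (Z x)‖ ^ 2 = 0 := by
      unfold circleDefect at hzero
      nlinarith [sq_nonneg (‖Z x‖ ^ 2 - 1), sq_nonneg ‖x - ι (Z x)‖]
    exact sub_eq_zero.mp (norm_eq_zero.mp (pow_eq_zero_iff two_ne_zero |>.mp this))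
  have hnorm : ‖Z x‖ = 1 := by
    have : (‖Z x‖ ^ 2 - 1) ^ 2 = 0 := by
      unfold circleDefect at hzero
      nlinarith [sq_nonneg (‖Z x‖ ^ 2 - 1), sq_nonneg ‖x - ι (Z x)‖]
    have h1 : ‖Z x‖ ^ 2 = 1 := by
      have := pow_eq_zero_iff two_ne_zero |>.mp this
      linarith
    nlinarith [norm_nonneg (Z x)]
  obtain ⟨θ, hθ⟩ := (Complex.norm_eq_one_iff (Z x)).mp hnorm
  have hinj : Function.Injective ι := Function.LeftInverse.injective (g := Z) hZ
  set g : ℝ → ℝ := fun t => t + a + ε * (1 - Real.cos (n * t)) with hg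
  have hexp : Complex.exp ((g^[n] θ : ℝ) * Complex.I) = Complex.exp (θ * Complex.I) := by
    apply hinj
    rw [← iterate_circleMap_exp hZ, hθ, ← hxι, hper]
  have hcos : Real.cos (n * θ) = 1 := by
    obtain ⟨q, hq⟩ := Complex.exp_eq_exp_iff_exists_int.mp hexp
    have hq' : g^[n] θ = θ + q * (2 * Real.pi) := by
      have h1 : ((g^[n] θ : ℝ) : ℂ) * Complex.I =
          ((θ + q * (2 * Real.pi) : ℝ) : ℂ) * Complex.I := by
        rw [hq]; push_cast; ring
      exact_mod_cast mul_right_cancel₀ Complex.I_ne_zero h1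
    obtain ⟨h1, h2⟩ := iterate_angle_mem n a hε.le θ n
    obtain ⟨k, hk⟩ := Nat.exists_eq_add_of_le' (show 1 ≤ n by omega)
    have h3 : θ + a + ε * (1 - Real.cos (n * θ)) + k * a ≤ g^[n] θ := by
      have := (iterate_angle_mem n a hε.le (g θ) k).1
      have e : g^[n] θ = g^[k] (g θ) := congrArg (fun q => g^[q] θ) hk
      rw [e]; exact this
    have hka : (k : ℝ) * a + a = 2 * Real.pi := by
      rw [← hna, hk]; push_cast; ring
    rw [← hg, hq', hna] at h2
    rw [← hg, hq', hna] at h1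
    have hpi := Real.pi_gt_three
    have hq1 : (q : ℝ) < 2 := by
      by_contra hge
      nlinarith [not_lt.mp hge]
    have hq2 : (q : ℝ) ≤ 1 := by
      have : q < 2 := by exact_mod_cast hq1
      exact_mod_cast (by omega : q ≤ 1)
    have h4 : ε * (1 - Real.cos (n * θ)) ≤ 0 := by nlinarith
    have h5 : 1 - Real.cos (n * θ) ≤ 0 := by
      by_contra hlt
      nlinarith [mul_pos hε (not_le.mp hlt)]
    linarith [Real.cos_le_one (n * θ)]
  have hpow : Z x ^ n = 1 := by
    obtain ⟨q, hq⟩ := (Real.cos_eq_one_iff _).mp hcos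
    rw [← hθ, ← Complex.exp_nat_mul, Complex.exp_eq_one_iff]
    refine ⟨q, ?_⟩
    have : ((n * θ : ℝ) : ℂ) = ((q * (2 * Real.pi) : ℝ) : ℂ) := by rw [hq]
    push_cast at this
    rw [← mul_assoc, ← this.symm]
    ring
  have : NeZero n := ⟨hn0⟩
  obtain ⟨j, -, hj⟩ := (Complex.isPrimitiveRoot_exp n hn0).eq_pow_of_pow_eq_one hpow
  refine ⟨j, ?_⟩
  rw [hf, ha, iterate_circleMap_one hZ hn0, hj, ← hxι]

end Model

/-! ### Dimension at least two -/

section HigherDimension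

theorem iterate_chartExt_symm {m : ℕ} {M : Type*} [TopologicalSpace M]
    {c : OpenPartialHomeomorph M (EuclideanSpace ℝ (Fin m))}
    {h : EuclideanSpace ℝ (Fin m) → EuclideanSpace ℝ (Fin m)} (hm : MapsTo h c.target c.target)
    {y : EuclideanSpace ℝ (Fin m)} (hy : y ∈ c.target) (j : ℕ) :
    (chartExt c h)^[j] (c.symm y) = c.symm (h^[j] y) := by
  induction j generalizing y with
  | zero => rfl
  | succ j ih =>
    rw [Function.iterate_succ_apply, Function.iterate_succ_apply, chartExt_symm hy, ih (hm hy)]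

theorem minimalPeriod_chartExt_symm {m : ℕ} {M : Type*} [TopologicalSpace M]
    {c : OpenPartialHomeomorph M (EuclideanSpace ℝ (Fin m))}
    {h : EuclideanSpace ℝ (Fin m) → EuclideanSpace ℝ (Fin m)} (hm : MapsTo h c.target c.target)
    {y : EuclideanSpace ℝ (Fin m)} (hy : y ∈ c.target) :
    Function.minimalPeriod (chartExt c h) (c.symm y) = Function.minimalPeriod h y := by
  rw [Function.minimalPeriod_eq_minimalPeriod_iff]
  intro j
  rw [Function.IsPeriodicPt, Function.IsPeriodicPt, Function.IsFixedPt, Function.IsFixedPt,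
    iterate_chartExt_symm hm hy]
  exact c.symm.injOn.eq_iff (hm.iterate j hy) hy

/-- A complex line embedded in a Euclidean space of dimension at least two. -/
theorem exists_complex_embedding {m : ℕ} (hm : 2 ≤ m) :
    ∃ (Z : EuclideanSpace ℝ (Fin m) →L[ℝ] ℂ) (ι : ℂ →L[ℝ] EuclideanSpace ℝ (Fin m)),
      ∀ z, Z (ι z) = z := by
  let i : Fin m := ⟨0, by omega⟩
  let j : Fin m := ⟨1, by omega⟩
  have hij : i ≠ j := by simp [i, j]
  refine ⟨(EuclideanSpace.proj i : EuclideanSpace ℝ (Fin m) →L[ℝ] ℝ).smulRight (1 : ℂ) +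
      (EuclideanSpace.proj j : EuclideanSpace ℝ (Fin m) →L[ℝ] ℝ).smulRight Complex.I,
    Complex.reCLM.smulRight (EuclideanSpace.single i 1) +
      Complex.imCLM.smulRight (EuclideanSpace.single j 1), fun z => ?_⟩
  apply Complex.ext <;> simp [hij, hij.symm]

variable {m : ℕ} {M : Type*} [TopologicalSpace M] [T2Space M] [Nonempty M]
  [ChartedSpace (EuclideanSpace ℝ (Fin m)) M] [IsManifold (𝓡 m) ∞ M]

/-- In dimension at least two, there are diffeomorphisms arbitrarily close to the identity with
exactly one cycle of some even length, hence without any square root, even among arbitrary maps. -/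
theorem exists_mem_forall_ne_sqrt_of_two_le (hm : 2 ≤ m) (W : Set (DiffC0 m M)) (hW : IsOpen W)
    (hid : (⟨DiffC.id, id_mem_DiffC0⟩ : DiffC0 m M) ∈ W) :
    ∃ φ ∈ W, ∀ ψ : M → M, ¬ ∀ x, ψ (ψ x) = φ.1.toDiff x := by
  obtain ⟨Z, ι, hZ⟩ := exists_complex_embedding hm
  obtain ⟨c, hc, hball⟩ :=
    exists_chart_closedBall_subset (m := m) (M := M) (Classical.arbitrary M) (1 + ‖ι‖ * 2)
  have hK := isCompact_circleDefect_le Z ι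
  have hKt : {x | circleDefect Z ι x ≤ 1 / 4} ⊆ c.target := fun x hx =>
    hball (mem_closedBall_zero_iff.mpr (norm_le_of_circleDefect_le Z ι hx))
  have hoff : ∀ n a ε, ∀ y ∉ {x | circleDefect Z ι x ≤ 1 / 4}, circleField Z ι n a ε y = 0 :=
    fun n a ε y hy => circleField_eq_zero Z ι (not_le.mp hy).le
  -- The pure rotations, for which the parameter `n` is irrelevant, are close to the identity
  -- when the angle is small.
  have hstep1 := eventually_exists_mem_of_family (u := fun a => circleField Z ι 0 a 0) (t₀ := 0)
    hc hK hKt ((contDiff_circleField Z ι 0).comp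
      (f := fun p : ℝ × EuclideanSpace ℝ (Fin m) => ((p.1, (0 : ℝ)), p.2))
      ((contDiff_fst.prodMk contDiff_const).prodMk contDiff_snd))
    (fun a => hoff 0 a 0) (fun y => by
      rw [show circleField Z ι 0 0 0 = fun _ => 0 from funext (circleField_zero Z ι 0)]
      simp) hW hid (fun x => by
      simp only [circleField_zero, add_zero, chartExt_id]; rfl)
  have hlim : Filter.Tendsto (fun k : ℕ => 2 * Real.pi / ((2 * (k + 1) : ℕ) : ℝ)) Filter.atTop
      (nhds 0) := by
    refine Filter.Tendsto.const_div_atTop ?_ _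
    refine tendsto_natCast_atTop_atTop.comp (Filter.tendsto_atTop_mono (fun k => ?_)
      Filter.tendsto_id)
    simp only [id]; omega
  obtain ⟨k, hk1, -, φ₀, hφ₀, hφ₀'⟩ := (hlim.eventually hstep1).exists
  set n := 2 * (k + 1) with hn
  set a := 2 * Real.pi / (n : ℝ) with ha
  have hind : circleField Z ι 0 a 0 = circleField Z ι n a 0 := by
    funext x; simp [circleField]
  rw [hind] at hk1 hφ₀'
  have hstep2 := eventually_exists_mem_of_family (u := fun ε => circleField Z ι n a ε) (t₀ := 0)
    hc hK hKt ((contDiff_circleField Z ι n).comp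
      (f := fun p : ℝ × EuclideanSpace ℝ (Fin m) => ((a, p.1), p.2))
      ((contDiff_const.prodMk contDiff_fst).prodMk contDiff_snd))
    (fun ε => hoff n a ε) hk1 hW hφ₀ hφ₀'
  have hsmall : ∀ᶠ ε : ℝ in nhds 0, ε < 1 / 4 ∧ n * ε < 3 :=
    (Filter.Tendsto.eventually_lt_const (by norm_num) Filter.tendsto_id).and
      ((continuous_const.mul continuous_id).continuousAt.eventually
        (Iio_mem_nhds (by simp)))
  obtain ⟨ε, ⟨⟨-, hmaps, φ, hφ, hφ'⟩, hε1, hε2⟩, hε⟩ :=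
    (((hstep2.and hsmall).filter_mono nhdsWithin_le_nhds).and
      (self_mem_nhdsWithin (s := Ioi (0 : ℝ)))).exists
  refine ⟨φ, hφ, fun ψ hψ => ?_⟩
  have hmaps' : MapsTo (circleMap Z ι n a ε) c.target c.target := hmaps
  have hφe : (φ.1.toDiff : M → M) = chartExt c (circleMap Z ι n a ε) := funext hφ'
  have h1t : ι 1 ∈ c.target := hKt (by simp [circleDefect, hZ])
  refine not_exists_sqrt_of_unique_cycle (f := φ.1.toDiff) (n := n) (p := c.symm (ι 1)) (by omega)
    (by simp [hn]) ?_ (fun x hx => ?_) φ.1.toDiff.injective hψ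
  · rw [hφe, minimalPeriod_chartExt_symm hmaps' h1t, minimalPeriod_circleMap_one hZ (by omega)]
  · rw [hφe] at hx ⊢
    have hxs : x ∈ c.source := by
      by_contra hxs
      have := Function.minimalPeriod_eq_one_iff_isFixedPt.mpr
        (chartExt_of_notMem (h := circleMap Z ι n a ε) hxs)
      omega
    rw [← c.left_inv hxs, minimalPeriod_chartExt_symm hmaps' (c.map_source hxs)] at hx
    obtain ⟨j, hj⟩ := exists_eq_iterate_of_minimalPeriod_eq hZ (by omega) hε hε1.le hε2 hx
    refine ⟨j, ?_⟩
    rw [iterate_chartExt_symm hmaps' h1t, ha, ← hj, c.left_inv hxs]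

end HigherDimension

/-! ### Germs commuting with a homothety -/

section Germ

open Filter Topology

/-- A function which is differentiable at `0` and homogeneous along a sequence tending to `0`
agrees with its derivative. -/
theorem eq_mul_of_forall_pow {G : ℝ → ℝ} {μ r w : ℝ} (hr0 : 0 < r) (hr1 : r < 1)
    (hG : HasDerivAt G μ 0) (hG0 : G 0 = 0) (h : ∀ n : ℕ, G (r ^ n * w) = r ^ n * G w) :
    G w = μ * w := by
  rcases eq_or_ne w 0 with rfl | hw
  · simp [hG0]
  have h1 : Tendsto (fun n : ℕ => r ^ n * w) atTop (𝓝[≠] 0) := by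
    refine tendsto_nhdsWithin_iff.mpr ⟨?_, Eventually.of_forall fun n => ?_⟩
    · simpa using (tendsto_pow_atTop_nhds_zero_of_lt_one hr0.le hr1).mul_const w
    · exact mul_ne_zero (pow_pos hr0 n).ne' hw
  have h2 := hG.tendsto_slope_zero.comp h1
  have h3 : ∀ n : ℕ, ((fun t => t⁻¹ • (G (0 + t) - G 0)) ∘ fun n : ℕ => r ^ n * w) n = G w / w := by
    intro n
    have := (pow_pos hr0 n).ne'
    simp only [Function.comp, zero_add, hG0, sub_zero, smul_eq_mul, h n]
    field_simp
  have h4 : G w / w = μ :=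
    tendsto_nhds_unique (tendsto_const_nhds.congr fun n => (h3 n).symm) h2
  rw [← h4, div_mul_cancel₀ _ hw]

/-- A function on `[0, δ)` which is differentiable at `0` and commutes with a homothety of factor
different from `1` is linear. -/
theorem eq_mul_of_commute {G : ℝ → ℝ} {μ l δ : ℝ} (hl : 0 < l) (hl1 : l ≠ 1)
    (hG : HasDerivAt G μ 0) (hG0 : G 0 = 0)
    (h : ∀ w ∈ Ioo 0 δ, l * w < δ → G (l * w) = l * G w) :
    ∀ w ∈ Ioo 0 δ, G w = μ * w := by
  have key : ∀ r, 0 < r → r < 1 → (∀ w ∈ Ioo 0 δ, G (r * w) = r * G w) →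
      ∀ w ∈ Ioo 0 δ, G w = μ * w := by
    intro r hr0 hr1 hr w hw
    refine eq_mul_of_forall_pow hr0 hr1 hG hG0 fun n => ?_
    induction n with
    | zero => simp
    | succ n ih =>
      have h1 : r ^ n ≤ 1 := pow_le_one₀ hr0.le hr1.le
      have h2 : r ^ n * w ∈ Ioo 0 δ :=
        ⟨mul_pos (pow_pos hr0 n) hw.1, (mul_le_of_le_one_left hw.1.le h1).trans_lt hw.2⟩
      rw [pow_succ', mul_assoc, hr _ h2, ih, mul_assoc]
  rcases lt_or_gt_of_ne hl1 with h1 | h1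
  · exact key l hl h1 fun w hw => h w hw
      ((mul_le_of_le_one_left hw.1.le h1.le).trans_lt hw.2)
  · refine key l⁻¹ (inv_pos.mpr hl) (inv_lt_one_of_one_lt₀ h1) fun w hw => ?_
    have h2 : l * (l⁻¹ * w) = w := by rw [← mul_assoc, mul_inv_cancel₀ hl.ne', one_mul]
    have h3 : l⁻¹ * w ∈ Ioo 0 δ := ⟨mul_pos (inv_pos.mpr hl) hw.1,
      (mul_le_of_le_one_left hw.1.le (inv_lt_one_of_one_lt₀ h1).le).trans_lt hw.2⟩
    have h4 := h _ h3 (by rw [h2]; exact hw.2)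
    rw [h2] at h4
    rw [h4, ← mul_assoc, inv_mul_cancel₀ hl.ne', one_mul]

end Germ

/-! ### Square roots of homeomorphisms of the line -/

section Line

open Filter Topology

theorem tendsto_iterate_right {F : ℝ → ℝ} (hF : Continuous F) {a b : ℝ}
    (hm : MapsTo F (Ioo a b) (Ioo a b)) (h : ∀ t ∈ Ioo a b, t < F t) {t : ℝ} (ht : t ∈ Ioo a b) :
    Tendsto (fun n => F^[n] t) atTop (𝓝 b) := by
  have hmem : ∀ n, F^[n] t ∈ Ioo a b := fun n => hm.iterate n ht
  have hmono : Monotone (fun n => F^[n] t) := monotone_nat_of_le_succ fun n => by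
    rw [Function.iterate_succ_apply']; exact (h _ (hmem n)).le
  have hbdd : BddAbove (range fun n => F^[n] t) := ⟨b, by rintro _ ⟨n, rfl⟩; exact (hmem n).2.le⟩
  have hlim := tendsto_atTop_ciSup hmono hbdd
  set L := ⨆ n, F^[n] t
  have hfix : F L = L := isFixedPt_of_tendsto_iterate hlim hF.continuousAt
  have hL1 : t ≤ L := le_ciSup hbdd 0
  have hL2 : L ≤ b := ciSup_le fun n => (hmem n).2.le
  rcases hL2.lt_or_eq with hlt | heq
  · exact absurd hfix (h L ⟨ht.1.trans_le hL1, hlt⟩).ne'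
  · rwa [heq] at hlim

theorem tendsto_iterate_left {F : ℝ → ℝ} (hF : Continuous F) {a b : ℝ}
    (hm : MapsTo F (Ioo a b) (Ioo a b)) (h : ∀ t ∈ Ioo a b, F t < t) {t : ℝ} (ht : t ∈ Ioo a b) :
    Tendsto (fun n => F^[n] t) atTop (𝓝 a) := by
  have h1 : ∀ s, s ∈ Ioo (-b) (-a) ↔ -s ∈ Ioo a b := fun s => by
    simp only [mem_Ioo]; constructor <;> rintro ⟨h1, h2⟩ <;> constructor <;> linarith
  have h2 := tendsto_iterate_right (F := fun s => -F (-s)) (by fun_prop) (a := -b) (b := -a)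
    (fun s hs => (h1 _).mpr (by simpa using hm ((h1 s).mp hs)))
    (fun s hs => by have := h _ ((h1 s).mp hs); linarith) (t := -t) ((h1 _).mpr (by simpa using ht))
  have h3 : ∀ n, (fun s => -F (-s))^[n] (-t) = -F^[n] t := fun n =>
    ((show Function.Semiconj Neg.neg F (fun s => -F (-s)) from
      fun s => by simp).iterate_right n t).symm
  simp only [h3] at h2
  simpa using h2.neg

/-- An increasing homeomorphism of the line supported in `[-2, 2]`, whose other fixed points
are `-1`, which is repelling, and `1`, which is attracting. -/
structure IsNorthSouth (f : ℝ ≃o ℝ) : Prop where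
  eq_self : ∀ t, 2 ≤ |t| → f t = t
  neg_one : f (-1) = -1
  one : f 1 = 1
  lt_apply : ∀ t ∈ Ioo (-1 : ℝ) 1, t < f t
  apply_lt : ∀ t, 1 < |t| → |t| < 2 → f t < t

namespace IsNorthSouth

variable {f : ℝ ≃o ℝ} (hf : IsNorthSouth f)
include hf

theorem two : f 2 = 2 := hf.eq_self 2 (by norm_num)

theorem neg_two : f (-2) = -2 := hf.eq_self (-2) (by norm_num)

omit hf in
theorem mapsTo_Ioo {a b : ℝ} (ha : f a = a) (hb : f b = b) : MapsTo f (Ioo a b) (Ioo a b) :=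
  fun t ht => ⟨by rw [← ha]; exact f.lt_iff_lt.mpr ht.1, by
    rw [← hb]; exact f.lt_iff_lt.mpr ht.2⟩

omit hf in
theorem mapsTo_symm_Ioo {a b : ℝ} (ha : f a = a) (hb : f b = b) :
    MapsTo f.symm (Ioo a b) (Ioo a b) :=
  mapsTo_Ioo (f := f.symm) (by rw [f.symm_apply_eq, ha]) (by rw [f.symm_apply_eq, hb])

theorem tendsto_iterate {t : ℝ} (ht : t ∈ Ioo (-1 : ℝ) 1) :
    Tendsto (fun n => f^[n] t) atTop (𝓝 1) :=
  tendsto_iterate_right f.continuous (mapsTo_Ioo hf.neg_one hf.one) hf.lt_apply ht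

theorem symm_apply_lt {t : ℝ} (ht : t ∈ Ioo (-1 : ℝ) 1) : f.symm t < t := by
  rw [f.symm_apply_lt]; exact hf.lt_apply t ht

theorem tendsto_symm_iterate {t : ℝ} (ht : t ∈ Ioo (-1 : ℝ) 1) :
    Tendsto (fun n => f.symm^[n] t) atTop (𝓝 (-1)) :=
  tendsto_iterate_left f.symm.continuous (mapsTo_symm_Ioo hf.neg_one hf.one)
    (fun _ h => hf.symm_apply_lt h) ht

theorem tendsto_iterate_of_one_lt {t : ℝ} (ht : t ∈ Ioo (1 : ℝ) 2) :
    Tendsto (fun n => f^[n] t) atTop (𝓝 1) := by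
  refine tendsto_iterate_left f.continuous (mapsTo_Ioo hf.one hf.two) (fun s hs => ?_) ht
  have : |s| = s := abs_of_pos (by linarith [hs.1])
  exact hf.apply_lt s (by rw [this]; exact hs.1) (by rw [this]; exact hs.2)

theorem tendsto_iterate_of_lt_neg_one {t : ℝ} (ht : t ∈ Ioo (-2 : ℝ) (-1)) :
    Tendsto (fun n => f^[n] t) atTop (𝓝 (-2)) := by
  refine tendsto_iterate_left f.continuous (mapsTo_Ioo hf.neg_two hf.neg_one) (fun s hs => ?_) ht
  have : |s| = -s := abs_of_neg (by linarith [hs.2])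
  exact hf.apply_lt s (by rw [this]; linarith [hs.2]) (by rw [this]; linarith [hs.1])

/-- The inverse, seen in the reflected coordinate, has the same dynamics. -/
theorem reflect {f' : ℝ ≃o ℝ} (hf' : ∀ t, f' t = -f.symm (-t)) : IsNorthSouth f' where
  eq_self t ht := by
    rw [hf', f.symm_apply_eq.mpr (hf.eq_self (-t) (by rwa [abs_neg])).symm, neg_neg]
  neg_one := by rw [hf', neg_neg, f.symm_apply_eq.mpr hf.one.symm]
  one := by rw [hf', f.symm_apply_eq.mpr hf.neg_one.symm, neg_neg]
  lt_apply t ht := by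
    have := hf.symm_apply_lt (t := -t) ⟨by linarith [ht.2], by linarith [ht.1]⟩
    rw [hf']; linarith
  apply_lt t h1 h2 := by
    have : -t < f.symm (-t) := by
      rw [f.lt_symm_apply]; exact hf.apply_lt (-t) (by rwa [abs_neg]) (by rwa [abs_neg])
    rw [hf']; linarith

end IsNorthSouth

/-- The homeomorphism `f` is affine near its hyperbolic fixed points, with factor `1 + s` at `-1`
and `1 - s` at `1`. -/
structure IsHyperbolicNorthSouth (s : ℝ) (f : ℝ ≃o ℝ) : Prop extends IsNorthSouth f where
  near_neg_one : ∀ᶠ w in 𝓝 (0 : ℝ), f (-1 + w) = -1 + (1 + s) * w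
  near_one : ∀ᶠ w in 𝓝 (0 : ℝ), f (1 + w) = 1 + (1 - s) * w

/-- A square root on `(-1, 1)` which is differentiable at the end points. -/
structure IsTameRoot (f : ℝ ≃o ℝ) (g : ℝ → ℝ) : Prop where
  mapsTo : MapsTo g (Ioo (-1) 1) (Ioo (-1) 1)
  apply_apply : ∀ t ∈ Ioo (-1 : ℝ) 1, g (g t) = f t
  neg_one : g (-1) = -1
  one : g 1 = 1
  differentiableAt_neg_one : DifferentiableAt ℝ g (-1)
  differentiableAt_one : DifferentiableAt ℝ g 1

namespace IsTameRoot

variable {f : ℝ ≃o ℝ} {g : ℝ → ℝ} (hg : IsTameRoot f g)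
include hg

theorem commute {t : ℝ} (ht : t ∈ Ioo (-1 : ℝ) 1) : g (f t) = f (g t) := by
  rw [← hg.apply_apply t ht, ← hg.apply_apply _ (hg.mapsTo ht)]

theorem commute_iterate (hf : IsNorthSouth f) (n : ℕ) {t : ℝ} (ht : t ∈ Ioo (-1 : ℝ) 1) :
    g (f^[n] t) = f^[n] (g t) := by
  induction n generalizing t with
  | zero => rfl
  | succ n ih =>
    rw [Function.iterate_succ_apply, Function.iterate_succ_apply,
      ih (IsNorthSouth.mapsTo_Ioo hf.neg_one hf.one ht), hg.commute ht]

/-- The germ of a tame square root at a hyperbolic end point is determined: it is the homothety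
whose factor is the positive square root. The end point is `-τ`, with `τ = ± 1`. -/
theorem eventually_eq_sqrt {τ l : ℝ} (hτ : τ = 1 ∨ τ = -1) (hl : 0 < l) (hl1 : l ≠ 1)
    (hfl : ∀ᶠ w in 𝓝 (0 : ℝ), f (-τ + w) = -τ + l * w) (hgτ : g (-τ) = -τ)
    (hgd : DifferentiableAt ℝ g (-τ)) :
    ∃ δ > 0, ∀ w ∈ Ioo 0 δ, g (-τ + τ * w) = -τ + τ * (√l * w) := by
  have hττ : τ * τ = 1 := by rcases hτ with rfl | rfl <;> norm_num
  have habs : |τ| = 1 := by rcases hτ with rfl | rfl <;> norm_num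
  have hcancel : ∀ a, τ * (τ * a) = a := fun a => by rw [← mul_assoc, hττ, one_mul]
  -- the expression of `g` in the coordinate `w ↦ -τ + τ w` of `[-1, 1]` centred at the end point
  set G : ℝ → ℝ := fun w => τ * (g (-τ + τ * w) + τ) with hGdef
  have hgG : ∀ w, g (-τ + τ * w) = -τ + τ * G w := fun w => by simp only [hGdef, hcancel]; ring
  have hG0 : G 0 = 0 := by simp [hGdef, hgτ]
  obtain ⟨μ, hμ⟩ : ∃ μ, HasDerivAt G μ 0 := by
    refine ⟨_, DifferentiableAt.hasDerivAt ?_⟩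
    have h1 : DifferentiableAt ℝ (fun w : ℝ => -τ + τ * w) 0 := by fun_prop
    have h2 : DifferentiableAt ℝ (fun w : ℝ => g (-τ + τ * w)) 0 :=
      DifferentiableAt.comp (0 : ℝ) (by simpa using hgd) h1
    exact (h2.add_const τ).const_mul τ
  obtain ⟨ρ, hρ, hfρ⟩ := Metric.eventually_nhds_iff.mp hfl
  obtain ⟨δ₀, hδ₀, hGρ⟩ := Metric.eventually_nhds_iff.mp
    (hμ.continuousAt.eventually (Metric.ball_mem_nhds (G 0) hρ))
  simp only [dist_zero_right, Real.norm_eq_abs, hG0] at hfρ hGρ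
  set δ := min 1 (min ρ δ₀)
  have hδ : 0 < δ := by positivity
  have hI : ∀ w ∈ Ioo 0 δ, -τ + τ * w ∈ Ioo (-1 : ℝ) 1 := fun w hw => by
    have : w < 1 := hw.2.trans_le (min_le_left _ _)
    rcases hτ with rfl | rfl <;> constructor <;> linarith [hw.1]
  have hρ' : ∀ w ∈ Ioo 0 δ, |w| < ρ ∧ |G w| < ρ := fun w hw => by
    rw [abs_of_pos hw.1]
    refine ⟨hw.2.trans_le ((min_le_right _ _).trans (min_le_left _ _)), hGρ ?_⟩
    rw [abs_of_pos hw.1]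
    exact hw.2.trans_le ((min_le_right _ _).trans (min_le_right _ _))
  have hfτ : ∀ w, |w| < ρ → f (-τ + τ * w) = -τ + τ * (l * w) := fun w hw => by
    rw [hfρ (by rwa [abs_mul, habs, one_mul])]; ring
  have hτinj : ∀ a b, -τ + τ * a = -τ + τ * b → a = b := fun a b hab => by
    rw [← hcancel a, ← hcancel b]; congr 1; linarith
  have hcomm : ∀ w ∈ Ioo 0 δ, l * w < δ → G (l * w) = l * G w := fun w hw _ => by
    apply hτinj
    rw [← hgG, ← hfτ w (hρ' w hw).1, hg.commute (hI w hw), hgG, hfτ _ (hρ' w hw).2]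
  have hlin := eq_mul_of_commute hl hl1 hμ hG0 hcomm
  have hpos : ∀ w ∈ Ioo 0 δ, 0 < G w := fun w hw => by
    have h1 := hg.mapsTo (hI w hw)
    rw [hgG] at h1
    rcases hτ with rfl | rfl
    · linarith [h1.1]
    · linarith [h1.2]
  have hhalf : δ / 2 ∈ Ioo 0 δ := ⟨by positivity, by linarith⟩
  have hμ0 : 0 < μ := by
    have := hpos _ hhalf
    rw [hlin _ hhalf] at this
    exact pos_of_mul_pos_left this hhalf.1.le
  have hμl : μ * μ = l := by
    obtain ⟨w, hw, hw'⟩ : ∃ w ∈ Ioo 0 δ, μ * w ∈ Ioo 0 δ := by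
      refine ⟨min (δ / 2) (δ / (2 * μ)), ⟨by positivity, (min_le_left _ _).trans_lt hhalf.2⟩,
        by positivity, ?_⟩
      calc μ * min (δ / 2) (δ / (2 * μ)) ≤ μ * (δ / (2 * μ)) := by gcongr; exact min_le_right _ _
        _ = δ / 2 := by field_simp
        _ < δ := hhalf.2
    have h1 := hg.apply_apply _ (hI w hw)
    rw [hgG, hlin w hw, hgG, hlin _ hw', hfτ w (hρ' w hw).1] at h1
    have h2 := hτinj _ _ h1
    rw [← mul_assoc] at h2
    exact mul_right_cancel₀ hw.1.ne' h2
  have hsqrt : √l = μ := by rw [← hμl]; exact Real.sqrt_mul_self hμ0.le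
  exact ⟨δ, hδ, fun w hw => by rw [hgG, hlin w hw, hsqrt]⟩

variable {s : ℝ} (hf : IsHyperbolicNorthSouth s f) (hs0 : 0 < s) (hs1 : s < 1)
include hf hs0

theorem germ_neg_one : ∃ δ > 0, ∀ t ∈ Ioo (-1) (-1 + δ), g t = -1 + √(1 + s) * (t + 1) := by
  obtain ⟨δ, hδ, h⟩ := hg.eventually_eq_sqrt (τ := 1) (l := 1 + s) (Or.inl rfl) (by linarith)
    (by linarith) hf.near_neg_one hg.neg_one hg.differentiableAt_neg_one
  refine ⟨δ, hδ, fun t ht => ?_⟩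
  have := h (t + 1) ⟨by linarith [ht.1], by linarith [ht.2]⟩
  simpa using this

include hs1 in
theorem germ_one : ∃ δ > 0, ∀ t ∈ Ioo (1 - δ) 1, g t = 1 - √(1 - s) * (1 - t) := by
  obtain ⟨δ, hδ, h⟩ := hg.eventually_eq_sqrt (τ := -1) (l := 1 - s) (Or.inr rfl) (by linarith)
    (by linarith) (by simpa using hf.near_one) (by simpa using hg.one)
    (by simpa using hg.differentiableAt_one)
  refine ⟨δ, hδ, fun t ht => ?_⟩
  have := h (1 - t) ⟨by linarith [ht.2], by linarith [ht.1]⟩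
  rw [show -(-1 : ℝ) + -1 * (1 - t) = t by ring] at this
  rw [this]; ring

/-- The root is determined by its germ at `-1`: its value at `t` is obtained by going back along
the orbit of `t` to a neighbourhood of `-1`, where the root is a homothety. -/
theorem exists_iterate_eq {t : ℝ} (ht : t ∈ Ioo (-1 : ℝ) 1) :
    ∀ᶠ n in atTop, f.symm^[n] t ∈ Ioo (-1 : ℝ) 1 ∧
      g (f.symm^[n] t) = -1 + √(1 + s) * (f.symm^[n] t + 1) ∧
      g t = f^[n] (g (f.symm^[n] t)) := by
  obtain ⟨δ, hδ, h⟩ := hg.germ_neg_one hf hs0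
  have h1 := (hf.tendsto_symm_iterate ht).eventually
    (gt_mem_nhds (show (-1 : ℝ) < -1 + δ by linarith))
  filter_upwards [h1] with n hn
  have h2 : f.symm^[n] t ∈ Ioo (-1 : ℝ) 1 :=
    (IsNorthSouth.mapsTo_symm_Ioo hf.neg_one hf.one).iterate n ht
  refine ⟨h2, h _ ⟨h2.1, hn⟩, ?_⟩
  rw [← hg.commute_iterate hf.toIsNorthSouth n h2,
    (Function.RightInverse.iterate (f := f) (g := f.symm) f.apply_symm_apply n) t]

theorem strictMonoOn : StrictMonoOn g (Ioo (-1) 1) := by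
  intro t ht t' ht' htt
  obtain ⟨n, ⟨-, h1, h2⟩, -, h3, h4⟩ :=
    ((hg.exists_iterate_eq hf hs0 ht).and (hg.exists_iterate_eq hf hs0 ht')).exists
  rw [h2, h4]
  apply f.strictMono.iterate n
  rw [h1, h3]
  have h5 : f.symm^[n] t < f.symm^[n] t' := f.symm.strictMono.iterate n htt
  have h6 : 0 < √(1 + s) := Real.sqrt_pos.mpr (by linarith)
  nlinarith

theorem lt_apply {t : ℝ} (ht : t ∈ Ioo (-1 : ℝ) 1) : t < g t := by
  obtain ⟨n, h0, h1, h2⟩ := (hg.exists_iterate_eq hf hs0 ht).exists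
  rw [h2]
  nth_rewrite 1 [← (Function.RightInverse.iterate (f := f) (g := f.symm) f.apply_symm_apply n) t]
  apply f.strictMono.iterate n
  rw [h1]
  have h6 : 1 < √(1 + s) := Real.lt_sqrt_of_sq_lt (by linarith)
  nlinarith [h0.1]

/-- Rigidity of tame square roots. If `f'` agrees with `f` off `(0, g 0)`, where `g` is a tame
square root of `f`, and if `f'` has a tame square root too, then `f' = f`. By uniqueness of the
germs at `-1` and `1`, the root `g'` agrees with `g` both on `(-1, g 0]` and on `[g 0, 1)`, and `g`
maps `(0, g 0)` into the latter. -/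
theorem eq_of_eqOn_compl {f' : ℝ ≃o ℝ} {g' : ℝ → ℝ} (hs1 : s < 1) (hg' : IsTameRoot f' g')
    (hf' : IsHyperbolicNorthSouth s f') (hff' : ∀ t ∉ Ioo 0 (g 0), f' t = f t) {t : ℝ}
    (ht : t ∈ Ioo 0 (g 0)) : f' t = f t := by
  have h0 : (0 : ℝ) ∈ Ioo (-1 : ℝ) 1 := by norm_num
  have hx1 : g 0 ∈ Ioo (-1 : ℝ) 1 := hg.mapsTo h0
  have hf0 : g 0 < f 0 := by
    rw [← hg.apply_apply 0 h0]; exact hg.lt_apply hf hs0 hx1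
  have hle : ∀ t, t ≤ 0 → f' t = f t := fun t ht => hff' t fun h => not_lt.mpr ht h.1
  have hge : ∀ t, g 0 ≤ t → f' t = f t := fun t ht => hff' t fun h => not_lt.mpr ht h.2
  have hmaps := IsNorthSouth.mapsTo_Ioo hf.neg_one hf.one
  have hmaps_symm := IsNorthSouth.mapsTo_symm_Ioo hf.neg_one hf.one
  -- pushing the germ at `-1` forward
  have hL : ∀ n : ℕ, ∀ y ∈ Ioo (-1 : ℝ) 1, y ≤ g 0 → g' (f.symm^[n] y) = g (f.symm^[n] y) →
      g' y = g y := by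
    intro n
    induction n with
    | zero => exact fun y _ _ h => h
    | succ n ih =>
      intro y hy hyx h
      rw [Function.iterate_succ_apply] at h
      have hxI := hmaps_symm hy
      have hx := ih (f.symm y) hxI ((hf.symm_apply_lt hy).le.trans hyx) h
      set x := f.symm y with hxdef
      have hfx : f x = y := f.apply_symm_apply y
      have hx0 : x ≤ 0 := by
        rw [← f.le_iff_le, hfx]; exact hyx.trans hf0.le
      have hgx : g x ≤ 0 := by
        rw [← f.le_iff_le, ← hg.commute hxI, hfx, ← hg.apply_apply 0 h0]
        exact (hg.strictMonoOn hf hs0).monotoneOn hy hx1 hyx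
      calc g' y = g' (f' x) := by rw [hle x hx0, hfx]
        _ = f' (g' x) := hg'.commute hxI
        _ = f (g x) := by rw [hx, hle _ hgx]
        _ = g y := by rw [← hg.commute hxI, hfx]
  -- pulling the germ at `1` back
  have hR : ∀ n : ℕ, ∀ y ∈ Ioo (-1 : ℝ) 1, g 0 ≤ y → g' (f^[n] y) = g (f^[n] y) →
      g' y = g y := by
    intro n
    induction n with
    | zero => exact fun y _ _ h => h
    | succ n ih =>
      intro y hy hyx h
      rw [Function.iterate_succ_apply] at h
      have hx := ih (f y) (hmaps hy) (hyx.trans (hf.lt_apply y hy).le) h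
      apply f'.injective
      rw [← hg'.commute hy, hge y hyx, hx, hge _ (hyx.trans (hg.lt_apply hf hs0 hy).le),
        hg.commute hy]
  have hL' : ∀ y ∈ Ioo (-1 : ℝ) 1, y ≤ g 0 → g' y = g y := by
    intro y hy hyx
    obtain ⟨δ, hδ, h1⟩ := hg'.germ_neg_one hf' hs0
    obtain ⟨n, hn, h2, h3, -⟩ := (((hf.tendsto_symm_iterate hy).eventually
      (gt_mem_nhds (show (-1 : ℝ) < -1 + δ by linarith))).and
      (hg.exists_iterate_eq hf hs0 hy)).exists
    exact hL n y hy hyx (by rw [h3, h1 _ ⟨h2.1, hn⟩])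
  have hR' : ∀ y ∈ Ioo (-1 : ℝ) 1, g 0 ≤ y → g' y = g y := by
    intro y hy hyx
    obtain ⟨δ, hδ, h1⟩ := hg'.germ_one hf' hs0 hs1
    obtain ⟨δ', hδ', h2⟩ := hg.germ_one hf hs0 hs1
    obtain ⟨n, hn, hn'⟩ := (((hf.tendsto_iterate hy).eventually
      (lt_mem_nhds (show 1 - δ < (1 : ℝ) by linarith))).and
      ((hf.tendsto_iterate hy).eventually
      (lt_mem_nhds (show 1 - δ' < (1 : ℝ) by linarith)))).exists
    have h3 : f^[n] y ∈ Ioo (-1 : ℝ) 1 := hmaps.iterate n hy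
    exact hR n y hy hyx (by rw [h1 _ ⟨hn, h3.2⟩, h2 _ ⟨hn', h3.2⟩])
  have htI : t ∈ Ioo (-1 : ℝ) 1 := ⟨by linarith [ht.1], ht.2.trans hx1.2⟩
  have hgt : g 0 ≤ g t := (hg.strictMonoOn hf hs0).monotoneOn h0 htI ht.1.le
  rw [← hg'.apply_apply t htI, hL' t htI ht.2.le, hR' _ (hg.mapsTo htI) hgt, hg.apply_apply t htI]

end IsTameRoot

end Line

/-! ### Diffeomorphisms of the line with two hyperbolic fixed points -/

section Models

open Filter Topology

theorem exists_orderIso_add {w : ℝ → ℝ} {k : NNReal} (hk : k < 1) (hl : LipschitzWith k w)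
    (hw : ∀ t, 2 ≤ |t| → w t = 0) : ∃ f : ℝ ≃o ℝ, ∀ t, f t = t + w t := by
  have hmono : StrictMono (fun t => t + w t) := by
    intro x y hxy
    have h1 := hl.dist_le_mul x y
    rw [Real.dist_eq, Real.dist_eq, abs_sub_comm x y, abs_of_pos (sub_pos.mpr hxy)] at h1
    have h2 : (k : ℝ) < 1 := by exact_mod_cast hk
    have h3 := le_abs_self (w x - w y)
    simp only
    nlinarith
  have hsurj : Function.Surjective (fun t => t + w t) := by
    refine Continuous.surjective (continuous_id.add hl.continuous) ?_ ?_
    · refine tendsto_id.congr' ?_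
      filter_upwards [eventually_ge_atTop 2] with t ht
      simp [hw t (ht.trans (le_abs_self t))]
    · refine tendsto_id.congr' ?_
      filter_upwards [eventually_le_atBot (-2)] with t ht
      simp [hw t (by have := neg_le_abs t; linarith)]
  exact ⟨hmono.orderIsoOfSurjective _ hsurj, fun t => rfl⟩

/-- A function supported in `[-2, 2]` which is `t + 1` near `-1` and `1 - t` near `1`, and does not
vanish at the other points of `(-2, 2)`. -/
noncomputable def lineField (t : ℝ) : ℝ :=
  Real.smoothTransition (4 - t ^ 2) * (Real.smoothTransition (t + 1 / 2) * (1 - t) +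
    (1 - Real.smoothTransition (t + 1 / 2)) * (t + 1))

/-- A smooth function which is positive exactly on `(0, x)`. -/
noncomputable def lineBump (x t : ℝ) : ℝ := expNegInvGlue t * expNegInvGlue (x - t)

theorem contDiff_lineField : ContDiff ℝ ∞ lineField := by
  unfold lineField
  have h1 : ContDiff ℝ ∞ Real.smoothTransition := Real.smoothTransition.contDiff
  have h2 : ContDiff ℝ ∞ (fun t : ℝ => Real.smoothTransition (4 - t ^ 2)) :=
    h1.comp (by fun_prop)
  have h3 : ContDiff ℝ ∞ (fun t : ℝ => Real.smoothTransition (t + 1 / 2)) :=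
    h1.comp (by fun_prop)
  exact h2.mul ((h3.mul (by fun_prop)).add ((contDiff_const.sub h3).mul (by fun_prop)))

theorem contDiff_lineBump (x : ℝ) : ContDiff ℝ ∞ (lineBump x) := by
  unfold lineBump
  have h1 : ContDiff ℝ ∞ expNegInvGlue := expNegInvGlue.contDiff
  exact h1.mul (h1.comp (by fun_prop))

theorem lineField_eq_zero {t : ℝ} (ht : 2 ≤ |t|) : lineField t = 0 := by
  have : 4 - t ^ 2 ≤ 0 := by rw [← sq_abs]; nlinarith
  simp [lineField, Real.smoothTransition.zero_of_nonpos this]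

theorem lineBump_eq_zero {x t : ℝ} (ht : t ∉ Ioo 0 x) : lineBump x t = 0 := by
  rw [mem_Ioo, not_and_or, not_lt, not_lt] at ht
  rcases ht with h | h
  · simp [lineBump, expNegInvGlue.zero_of_nonpos h]
  · simp [lineBump, expNegInvGlue.zero_of_nonpos (sub_nonpos.mpr h)]

theorem lineBump_pos {x t : ℝ} (ht : t ∈ Ioo 0 x) : 0 < lineBump x t :=
  mul_pos (expNegInvGlue.pos_of_pos ht.1) (expNegInvGlue.pos_of_pos (sub_pos.mpr ht.2))

theorem lineBump_nonneg (x t : ℝ) : 0 ≤ lineBump x t :=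
  mul_nonneg (expNegInvGlue.nonneg _) (expNegInvGlue.nonneg _)

theorem lineField_near_neg_one {t : ℝ} (h1 : -(3 / 2) ≤ t) (h2 : t ≤ -(1 / 2)) :
    lineField t = t + 1 := by
  rw [lineField, Real.smoothTransition.one_of_one_le (by nlinarith),
    Real.smoothTransition.zero_of_nonpos (by linarith)]
  ring

theorem lineField_near_one {t : ℝ} (h1 : 1 / 2 ≤ t) (h2 : t ≤ 3 / 2) : lineField t = 1 - t := by
  rw [lineField, Real.smoothTransition.one_of_one_le (x := 4 - t ^ 2) (by nlinarith),
    Real.smoothTransition.one_of_one_le (by linarith)]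
  ring

theorem lineField_pos {t : ℝ} (ht : t ∈ Ioo (-1 : ℝ) 1) : 0 < lineField t := by
  obtain ⟨h1, h2⟩ := ht
  have h3 : 0 < Real.smoothTransition (4 - t ^ 2) :=
    Real.smoothTransition.pos_of_pos (by nlinarith)
  have h4 := Real.smoothTransition.nonneg (t + 1 / 2)
  have h5 := Real.smoothTransition.le_one (t + 1 / 2)
  refine mul_pos h3 ?_
  nlinarith [mul_nonneg h4 (sub_nonneg.mpr h2.le), mul_nonneg (sub_nonneg.mpr h5) (by linarith :
    0 ≤ t + 1)]

theorem lineField_neg {t : ℝ} (h1 : 1 < |t|) (h2 : |t| < 2) : lineField t < 0 := by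
  have h3 : 0 < Real.smoothTransition (4 - t ^ 2) :=
    Real.smoothTransition.pos_of_pos (by rw [← sq_abs]; nlinarith [abs_nonneg t])
  refine mul_neg_of_pos_of_neg h3 ?_
  rcases lt_abs.mp h1 with h | h
  · rw [Real.smoothTransition.one_of_one_le (by linarith)]; linarith
  · rw [Real.smoothTransition.zero_of_nonpos (by linarith)]; linarith

theorem isHyperbolicNorthSouth_of_eq {s ε x : ℝ} (hs : 0 < s) (hε : 0 ≤ ε)
    (hx1 : x < 1) {f : ℝ ≃o ℝ} (hf : ∀ t, f t = t + (s * lineField t + ε * lineBump x t)) :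
    IsHyperbolicNorthSouth s f where
  eq_self t ht := by
    have : t ∉ Ioo 0 x := fun h => by
      rw [abs_of_pos h.1] at ht; linarith [h.2]
    rw [hf, lineField_eq_zero ht, lineBump_eq_zero this]; ring
  neg_one := by
    rw [hf, lineField_near_neg_one (by norm_num) (by norm_num),
      lineBump_eq_zero (fun h => by linarith [h.1])]
    ring
  one := by
    rw [hf, lineField_near_one (by norm_num) (by norm_num),
      lineBump_eq_zero (fun h => by linarith [h.2])]
    ring
  lt_apply t ht := by
    rw [hf]
    have := mul_pos hs (lineField_pos ht)
    have := mul_nonneg hε (lineBump_nonneg x t)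
    linarith
  apply_lt t h1 h2 := by
    have : t ∉ Ioo 0 x := fun h => by
      rw [abs_of_pos h.1] at h1; linarith [h.2]
    rw [hf, lineBump_eq_zero this]
    have := mul_neg_of_pos_of_neg hs (lineField_neg h1 h2)
    linarith
  near_neg_one := by
    filter_upwards [Metric.ball_mem_nhds (0 : ℝ) (show (0 : ℝ) < 1 / 2 by norm_num)] with w hw
    rw [mem_ball_zero_iff, Real.norm_eq_abs, abs_lt] at hw
    rw [hf, lineField_near_neg_one (by linarith) (by linarith),
      lineBump_eq_zero (fun h => by linarith [h.1])]
    ring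
  near_one := by
    filter_upwards [Metric.ball_mem_nhds (0 : ℝ) (show (0 : ℝ) < 1 / 2 by norm_num),
      lt_mem_nhds (show x - 1 < 0 by linarith)] with w hw hw'
    rw [mem_ball_zero_iff, Real.norm_eq_abs, abs_lt] at hw
    rw [hf, lineField_near_one (by linarith) (by linarith),
      lineBump_eq_zero (fun h => by linarith [h.2])]
    ring

end Models

/-! ### Maps modelled on a homeomorphism of the line -/

section OnManifold

open Filter Topology

variable {M : Type*} [TopologicalSpace M]

theorem eventually_mem_source_and {q : OpenPartialHomeomorph M ℝ} {t a b : ℝ} (ht : t ∈ q.target)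
    (htab : t ∈ Ioo a b) : ∀ᶠ y in 𝓝 (q.symm t), y ∈ q.source ∧ q y ∈ Ioo a b := by
  have hqt := q.map_target ht
  have h1 : ∀ᶠ y in 𝓝 (q.symm t), q y ∈ Ioo a b :=
    (q.continuousAt hqt).eventually (by rw [q.right_inv ht]; exact Ioo_mem_nhds htab.1 htab.2)
  filter_upwards [q.open_source.mem_nhds hqt, h1] with y hy hy' using ⟨hy, hy'⟩

/-- The bijection `Φ` of `M` is given by `f` in the coordinate `q`, and is the identity outside
the domain of `q`. -/
structure IsModelledOn (q : OpenPartialHomeomorph M ℝ) (f : ℝ ≃o ℝ) (Φ : M ≃ M) : Prop where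
  Icc_subset : Icc (-3) 3 ⊆ q.target
  mapsTo : MapsTo f q.target q.target
  apply_symm : ∀ t ∈ q.target, Φ (q.symm t) = q.symm (f t)
  eq_self : ∀ x ∉ q.source, Φ x = x

/-- A square root of `Φ` which fixes the two hyperbolic fixed points `q⁻¹ (±1)`, and is
differentiable there. -/
structure IsTameSqrt (q : OpenPartialHomeomorph M ℝ) (Φ : M → M) (ψ : M → M) : Prop where
  apply_apply : ∀ x, ψ (ψ x) = Φ x
  fixed : ∀ i : ℝ, i = -1 ∨ i = 1 → ψ (q.symm i) = q.symm i
  continuousAt : ∀ i : ℝ, i = -1 ∨ i = 1 → ContinuousAt ψ (q.symm i)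
  differentiableAt : ∀ i : ℝ, i = -1 ∨ i = 1 → DifferentiableAt ℝ (q ∘ ψ ∘ q.symm) i

namespace IsModelledOn

variable {q : OpenPartialHomeomorph M ℝ} {f : ℝ ≃o ℝ} {Φ : M ≃ M} (h : IsModelledOn q f Φ)
include h

theorem mem_target {t : ℝ} (h1 : -3 ≤ t) (h2 : t ≤ 3) : t ∈ q.target := h.Icc_subset ⟨h1, h2⟩

theorem iterate_symm {t : ℝ} (ht : t ∈ q.target) (n : ℕ) :
    Φ^[n] (q.symm t) = q.symm (f^[n] t) := by
  induction n generalizing t with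
  | zero => rfl
  | succ n ih =>
    rw [Function.iterate_succ_apply, Function.iterate_succ_apply, h.apply_symm t ht,
      ih (h.mapsTo ht)]

/-- The description of the inverse in the reflected coordinate. -/
theorem reflect (hf : IsNorthSouth f) {f' : ℝ ≃o ℝ} (hf' : ∀ t, f' t = -f.symm (-t)) :
    IsModelledOn (q.transHomeomorph (Homeomorph.neg ℝ)) f' Φ.symm := by
  have hmem : ∀ t, t ∈ (q.transHomeomorph (Homeomorph.neg ℝ)).target ↔ -t ∈ q.target :=
    fun t => Iff.rfl
  have hsymm : ∀ t ∈ q.target, f.symm t ∈ q.target := by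
    intro t ht
    by_cases ht2 : 2 ≤ |t|
    · rwa [f.symm_apply_eq.mpr (hf.eq_self t ht2).symm]
    · have h1 := IsNorthSouth.mapsTo_symm_Ioo hf.neg_two hf.two (abs_lt.mp (not_le.mp ht2))
      exact h.mem_target (by linarith [h1.1]) (by linarith [h1.2])
  refine ⟨fun t ht => ?_, fun t ht => ?_, fun t ht => ?_, fun x hx => ?_⟩
  · rw [hmem]; exact h.mem_target (by linarith [ht.2]) (by linarith [ht.1])
  · rw [hmem, hf', neg_neg]; exact hsymm _ ht
  · change Φ.symm (q.symm (-t)) = q.symm (-f' t)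
    rw [hf', neg_neg, Equiv.symm_apply_eq, h.apply_symm _ (hsymm (-t) ht),
      f.apply_symm_apply]
  · rw [Equiv.symm_apply_eq, h.eq_self x hx]

theorem tendsto_iterate (hf : IsNorthSouth f) {t : ℝ} (ht : t ∈ Ioo (-1 : ℝ) 1) :
    Tendsto (fun n => Φ^[n] (q.symm t)) atTop (𝓝 (q.symm 1)) := by
  have h1 : ContinuousAt q.symm 1 :=
    q.continuousAt_symm (h.mem_target (by norm_num) (by norm_num))
  refine (h1.tendsto.comp (hf.tendsto_iterate ht)).congr fun n => ?_
  exact (h.iterate_symm (h.mem_target (by linarith [ht.1]) (by linarith [ht.2])) n).symm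

/-- A map which commutes with `Φ` and fixes the attracting point preserves its basin. -/
theorem exists_apply_eq (hf : IsNorthSouth f) {ψ : M → M}
    (hψ : ∀ x, ψ (Φ x) = Φ (ψ x)) (hψ1 : ψ (q.symm 1) = q.symm 1)
    (hψc : ContinuousAt ψ (q.symm 1)) {t : ℝ} (ht : t ∈ Ioo (-1 : ℝ) 1) :
    ∃ t' ∈ Ioo (-1 : ℝ) 2, ψ (q.symm t) = q.symm t' := by
  have h1t : (1 : ℝ) ∈ q.target := h.mem_target (by norm_num) (by norm_num)
  have hiter : ∀ n, ψ (Φ^[n] (q.symm t)) = Φ^[n] (ψ (q.symm t)) := fun n =>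
    (show Function.Commute ψ Φ from hψ).iterate_right n _
  have hlim : Tendsto (fun n => Φ^[n] (ψ (q.symm t))) atTop (𝓝 (q.symm 1)) := by
    have := hψc.tendsto.comp (h.tendsto_iterate hf ht)
    rw [hψ1] at this
    exact this.congr hiter
  have hnear := eventually_mem_source_and h1t (show (1 : ℝ) ∈ Ioo (-1 : ℝ) 2 by norm_num)
  have hback : ∀ y, (Φ y ∈ q.source ∧ q (Φ y) ∈ Ioo (-1 : ℝ) 2) →
      y ∈ q.source ∧ q y ∈ Ioo (-1 : ℝ) 2 := by
    rintro y ⟨hy1, hy2⟩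
    by_cases hy : y ∈ q.source
    · refine ⟨hy, ?_⟩
      rw [← q.left_inv hy, h.apply_symm _ (q.map_source hy),
        q.right_inv (h.mapsTo (q.map_source hy))] at hy2
      have := IsNorthSouth.mapsTo_symm_Ioo hf.neg_one hf.two hy2
      rwa [f.symm_apply_apply] at this
    · rw [h.eq_self y hy] at hy1; exact absurd hy1 hy
  have hback' : ∀ n y, (Φ^[n] y ∈ q.source ∧ q (Φ^[n] y) ∈ Ioo (-1 : ℝ) 2) →
      y ∈ q.source ∧ q y ∈ Ioo (-1 : ℝ) 2 := by
    intro n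
    induction n with
    | zero => exact fun y hy => hy
    | succ n ih => exact fun y hy => hback y (ih (Φ y) hy)
  obtain ⟨n, hn⟩ := (hlim.eventually hnear).exists
  obtain ⟨h1, h2⟩ := hback' n _ hn
  exact ⟨_, h2, (q.left_inv h1).symm⟩

/-- The attracting point `q⁻¹ 1` is the only isolated fixed point which is the limit of a
nonconstant orbit. -/
theorem eq_symm_one [T2Space M] (hf : IsNorthSouth f) {p x : M} (hxp : x ≠ p)
    (hx : Tendsto (fun n => Φ^[n] x) atTop (𝓝 p)) (hp : ∀ᶠ y in 𝓝 p, Φ y = y → y = p) :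
    p = q.symm 1 := by
  have hnf : Φ x ≠ x := fun hfix => by
    have : (fun n => Φ^[n] x) = fun _ => x := funext fun n => Function.iterate_fixed hfix n
    rw [this] at hx
    exact hxp (tendsto_nhds_unique tendsto_const_nhds hx)
  have hxs : x ∈ q.source := by
    by_contra hxs; exact hnf (h.eq_self x hxs)
  obtain ⟨t, ht, rfl⟩ : ∃ t ∈ q.target, x = q.symm t :=
    ⟨q x, q.map_source hxs, (q.left_inv hxs).symm⟩
  have hft : f t ≠ t := fun hft => hnf (by rw [h.apply_symm t ht, hft])
  have hlim : ∀ a ∈ q.target, Tendsto (fun n => f^[n] t) atTop (𝓝 a) → p = q.symm a := by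
    intro a ha hta
    refine tendsto_nhds_unique hx (((q.continuousAt_symm ha).tendsto.comp hta).congr fun n => ?_)
    exact (h.iterate_symm ht n).symm
  have h1t : (1 : ℝ) ∈ q.target := h.mem_target (by norm_num) (by norm_num)
  have h2t : (-2 : ℝ) ∈ q.target := h.mem_target (by norm_num) (by norm_num)
  have ht2 : |t| < 2 := by
    by_contra hge; exact hft (hf.eq_self t (not_lt.mp hge))
  obtain ⟨hta, htb⟩ := abs_lt.mp ht2
  rcases lt_trichotomy t (-1) with h1 | h1 | h1
  · exfalso
    have hp2 := hlim _ h2t (hf.tendsto_iterate_of_lt_neg_one ⟨hta, h1⟩)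
    rw [hp2] at hp
    have h3 := (q.continuousAt_symm h2t).eventually hp
    have h4 : ∀ᶠ a in 𝓝[<] (-2 : ℝ), a ∈ Ioo (-3 : ℝ) (-2) := Ioo_mem_nhdsLT (by norm_num)
    obtain ⟨a, ha1, ha2⟩ := ((h3.filter_mono nhdsWithin_le_nhds).and h4).exists
    have hat : a ∈ q.target := h.mem_target ha2.1.le (by linarith [ha2.2])
    have hfa : f a = a := hf.eq_self a (by rw [abs_of_neg] <;> linarith [ha2.2])
    have h5 := q.symm.injOn hat h2t (ha1 (by rw [h.apply_symm a hat, hfa]))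
    linarith [ha2.2]
  · exact absurd (by rw [h1]; exact hf.neg_one) hft
  · rcases lt_trichotomy t 1 with h2 | h2 | h2
    · exact hlim _ h1t (hf.tendsto_iterate ⟨h1, h2⟩)
    · exact absurd (by rw [h2]; exact hf.one) hft
    · exact hlim _ h1t (hf.tendsto_iterate_of_one_lt ⟨h2, htb⟩)

/-- A homeomorphism which commutes with `Φ` fixes the attracting point. -/
theorem apply_symm_one_eq [T2Space M] (hf : IsNorthSouth f) (D : M ≃ₜ M)
    (hD : ∀ x, D (Φ x) = Φ (D x)) : D (q.symm 1) = q.symm 1 := by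
  have h1t : (1 : ℝ) ∈ q.target := h.mem_target (by norm_num) (by norm_num)
  have h0t : (0 : ℝ) ∈ q.target := h.mem_target (by norm_num) (by norm_num)
  have hiso : ∀ᶠ y in 𝓝 (q.symm 1), Φ y = y → y = q.symm 1 := by
    filter_upwards [eventually_mem_source_and h1t (show (1 : ℝ) ∈ Ioo (0 : ℝ) 2 by norm_num)]
      with y hy hfix
    obtain ⟨hys, hy0, hy2⟩ := hy
    have hfq : f (q y) = q y := by
      conv_rhs => rw [← hfix, ← q.left_inv hys, h.apply_symm _ (q.map_source hys),
        q.right_inv (h.mapsTo (q.map_source hys))]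
    have habs : |q y| = q y := abs_of_pos hy0
    rcases lt_trichotomy (q y) 1 with h1 | h1 | h1
    · exact absurd hfq (hf.lt_apply _ ⟨by linarith, h1⟩).ne'
    · rw [← h1, q.left_inv hys]
    · exact absurd hfq (hf.apply_lt _ (by rwa [habs]) (by rwa [habs])).ne
  refine h.eq_symm_one hf (x := D (q.symm 0)) ?_ ?_ ?_
  · rw [D.injective.ne_iff, q.symm.injOn.ne_iff h0t h1t]; norm_num
  · refine ((D.continuous.tendsto _).comp (h.tendsto_iterate hf (t := 0) (by norm_num))).congr
      fun n => ?_
    exact (show Function.Commute D Φ from hD).iterate_right n _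
  · have h2 : Tendsto D.symm (𝓝 (D (q.symm 1))) (𝓝 (q.symm 1)) := by
      have := D.symm.continuous.tendsto (D (q.symm 1))
      rwa [D.symm_apply_apply] at this
    filter_upwards [h2.eventually hiso] with y hy hfix
    rw [← hy, D.apply_symm_apply]
    apply D.injective
    rw [hD, D.apply_symm_apply, hfix]

omit h in
theorem exists_reflect (f : ℝ ≃o ℝ) : ∃ f' : ℝ ≃o ℝ, ∀ t, f' t = -f.symm (-t) :=
  ⟨(OrderIso.neg ℝ).trans (f.symm.dual.trans (OrderIso.neg ℝ).symm), fun _ => rfl⟩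

theorem apply_symm_neg_one_eq [T2Space M] (hf : IsNorthSouth f) (D : M ≃ₜ M)
    (hD : ∀ x, D (Φ x) = Φ (D x)) : D (q.symm (-1)) = q.symm (-1) := by
  obtain ⟨f', hf'⟩ := exists_reflect f
  refine (h.reflect hf hf').apply_symm_one_eq (hf.reflect hf') D fun x => ?_
  rw [Equiv.eq_symm_apply, ← hD, Equiv.apply_symm_apply]

/-- A tame square root of `Φ` restricts to a tame square root on the interval between the two
hyperbolic points, which is the intersection of the basin of `1` for `Φ` and of the basin of `-1`
for its inverse. -/
theorem isTameRoot (hf : IsNorthSouth f) {ψ : M → M} (hψ : IsTameSqrt q Φ ψ) :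
    IsTameRoot f (q ∘ ψ ∘ q.symm) := by
  have hcomm : ∀ x, ψ (Φ x) = Φ (ψ x) := fun x => by rw [← hψ.apply_apply, ← hψ.apply_apply]
  have key : ∀ t ∈ Ioo (-1 : ℝ) 1, ∃ t' ∈ Ioo (-1 : ℝ) 1, ψ (q.symm t) = q.symm t' := by
    intro t ht
    obtain ⟨a, ha, hta⟩ := h.exists_apply_eq hf hcomm (hψ.fixed 1 (Or.inr rfl))
      (hψ.continuousAt 1 (Or.inr rfl)) ht
    obtain ⟨f', hf'⟩ := exists_reflect f
    obtain ⟨b, hb, htb⟩ := (h.reflect hf hf').exists_apply_eq (hf.reflect hf') (ψ := ψ)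
      (fun x => by rw [Equiv.eq_symm_apply, ← hcomm, Equiv.apply_symm_apply])
      (hψ.fixed (-1) (Or.inl rfl)) (hψ.continuousAt (-1) (Or.inl rfl))
      (t := -t) ⟨by linarith [ht.2], by linarith [ht.1]⟩
    change ψ (q.symm (- -t)) = q.symm (-b) at htb
    rw [neg_neg, hta] at htb
    have hab : a = -b := q.symm.injOn (h.mem_target (by linarith [ha.1]) (by linarith [ha.2]))
      (h.mem_target (by linarith [hb.2]) (by linarith [hb.1])) htb
    exact ⟨a, ⟨ha.1, by linarith [hb.1]⟩, hta⟩
  have hmem : ∀ t ∈ Ioo (-1 : ℝ) 1, t ∈ q.target := fun t ht =>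
    h.mem_target (by linarith [ht.1]) (by linarith [ht.2])
  have hfix : ∀ i : ℝ, i = -1 ∨ i = 1 → (q ∘ ψ ∘ q.symm) i = i := fun i hi => by
    have hit : i ∈ q.target := by
      rcases hi with rfl | rfl <;> exact h.mem_target (by norm_num) (by norm_num)
    simp only [Function.comp, hψ.fixed i hi, q.right_inv hit]
  refine ⟨fun t ht => ?_, fun t ht => ?_, hfix _ (Or.inl rfl), hfix _ (Or.inr rfl),
    hψ.differentiableAt _ (Or.inl rfl), hψ.differentiableAt _ (Or.inr rfl)⟩
  · obtain ⟨t', ht', htt⟩ := key t ht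
    simp only [Function.comp, htt, q.right_inv (hmem t' ht')]
    exact ht'
  · obtain ⟨t', ht', htt⟩ := key t ht
    simp only [Function.comp]
    rw [htt, q.right_inv (hmem t' ht'), ← htt, hψ.apply_apply, h.apply_symm t (hmem t ht),
      q.right_inv (h.mapsTo (hmem t ht))]

end IsModelledOn

end OnManifold

/-! ### Autonomous diffeomorphisms -/

section Flow

variable {m : ℕ} {M : Type*} [TopologicalSpace M] [T2Space M]
  [ChartedSpace (EuclideanSpace ℝ (Fin m)) M] [IsManifold (𝓡 m) ∞ M]

/-- The flow of a vector field whose time `1` map is a given autonomous diffeomorphism. -/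
theorem exists_flow_of_mem_Aut {φ : DiffC m M} (hφ : φ ∈ Aut m M) :
    ∃ (X : ∀ x : M, TangentSpace (𝓡 m) x) (γ : M → ℝ → M),
      ContMDiff (𝓡 m) (𝓡 m).tangent ∞ (fun x => (⟨x, X x⟩ : TangentBundle (𝓡 m) M)) ∧
      (∀ x, IsMIntegralCurve (I := 𝓡 m) (γ x) X) ∧ (∀ x, γ x 0 = x) ∧
      (∀ x, γ x 1 = φ.toDiff x) ∧ ∀ x s t, γ (γ x s) t = γ x (t + s) := by
  have : IsManifold (𝓡 m) 1 M := IsManifold.of_le (n := ∞) (by simp)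
  obtain ⟨X, hX, -, hexp⟩ := hφ
  choose γ hγ h0 h1 using hexp
  refine ⟨X, γ, hX, hγ, h0, h1, fun x s t => ?_⟩
  have := isMIntegralCurve_Ioo_eq_of_contMDiff_boundaryless (t₀ := 0) (hX.of_le (by simp))
    (hγ (γ x s)) ((hγ x).comp_add s) (by simp [h0])
  exact congrFun this t

end Flow

/-! ### Vector fields in a one-dimensional coordinate -/

section PulledBackField

variable {m : ℕ} {M : Type*} [TopologicalSpace M] [ChartedSpace (EuclideanSpace ℝ (Fin m)) M]
  {q : OpenPartialHomeomorph M ℝ} {X : ∀ x : M, TangentSpace (𝓡 m) x}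

variable (q X) in
/-- The vector field `X` in the coordinate `q`, as a function on the line. It is meaningful on the
target of `q`. -/
noncomputable def coordField (t : ℝ) : ℝ :=
  VectorField.mpullback 𝓘(ℝ, ℝ) (𝓡 m) q.symm X t

theorem mfderiv_symm_isInvertible (hq : q.MDifferentiable (𝓡 m) 𝓘(ℝ, ℝ)) {t : ℝ}
    (ht : t ∈ q.target) : (mfderiv 𝓘(ℝ, ℝ) (𝓡 m) q.symm t).IsInvertible := by
  have h1 := hq.symm_comp_deriv (q.map_target ht)
  rw [q.right_inv ht] at h1
  exact ContinuousLinearMap.IsInvertible.of_inverse h1 (hq.comp_symm_deriv ht)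

theorem mfderiv_symm_coordField (hq : q.MDifferentiable (𝓡 m) 𝓘(ℝ, ℝ)) {t : ℝ}
    (ht : t ∈ q.target) :
    mfderiv 𝓘(ℝ, ℝ) (𝓡 m) q.symm t (coordField q X t) =
      X (q.symm t) :=
  ((mfderiv_symm_isInvertible hq ht).inverse_apply_eq.mp rfl).symm

theorem coordField_eq_mfderiv (hq : q.MDifferentiable (𝓡 m) 𝓘(ℝ, ℝ)) {x : M}
    (hx : x ∈ q.source) :
    coordField q X (q x) =
      mfderiv (𝓡 m) 𝓘(ℝ, ℝ) q x (X x) := by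
  have h1 := mfderiv_symm_coordField (X := X) hq (q.map_source hx)
  have h2 := hq.comp_symm_deriv (q.map_source hx)
  rw [q.left_inv hx] at h1 h2
  rw [← h1]
  exact (congrArg (fun A : ℝ →L[ℝ] ℝ =>
    A (coordField q X (q x))) h2).symm

/-- In a coordinate `q`, an integral curve of `X` solves the equation of the pulled back field. -/
theorem hasDerivAt_comp_of_isMIntegralCurve (hq : q.MDifferentiable (𝓡 m) 𝓘(ℝ, ℝ)) {γ : ℝ → M}
    (hγ : IsMIntegralCurve (I := 𝓡 m) γ X) {t : ℝ} (ht : γ t ∈ q.source) :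
    HasDerivAt (q ∘ γ) (coordField q X (q (γ t))) t := by
  have h1 := (hq.mdifferentiableAt ht).hasMFDerivAt.comp t (hγ t)
  refine hasDerivAt_iff_hasFDerivAt.mpr (hasMFDerivAt_iff_hasFDerivAt.mp (h1.congr_mfderiv ?_))
  ext
  change mfderiv (𝓡 m) 𝓘(ℝ, ℝ) q (γ t) ((1 : ℝ) • X (γ t)) =
    (1 : ℝ) • coordField q X (q (γ t))
  rw [map_smul, coordField_eq_mfderiv hq ht]
  rfl

/-- Conversely, solutions of the equation of the pulled back field are integral curves. -/
theorem isMIntegralCurveOn_symm_comp (hq : q.MDifferentiable (𝓡 m) 𝓘(ℝ, ℝ)) {y : ℝ → ℝ}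
    {s : Set ℝ} (hy : ∀ t ∈ s, y t ∈ q.target)
    (hd : ∀ t ∈ s, HasDerivAt y (coordField q X (y t)) t) :
    IsMIntegralCurveOn (I := 𝓡 m) (q.symm ∘ y) X s := by
  intro t ht
  have h1 := (hq.mdifferentiableAt_symm (hy t ht)).hasMFDerivAt.comp t
    (hasMFDerivAt_iff_hasFDerivAt.mpr (hd t ht).hasFDerivAt)
  refine (h1.congr_mfderiv ?_).hasMFDerivWithinAt
  ext
  exact (congrArg (mfderiv 𝓘(ℝ, ℝ) (𝓡 m) q.symm (y t)) (one_smul ℝ (coordField q X (y t)))).trans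
    ((mfderiv_symm_coordField hq (hy t ht)).trans (one_smul ℝ _).symm)

variable [IsManifold (𝓡 m) ∞ M]

theorem differentiableAt_coordField (hq : q.MDifferentiable (𝓡 m) 𝓘(ℝ, ℝ))
    (hqs : ContMDiffOn 𝓘(ℝ, ℝ) (𝓡 m) ∞ q.symm q.target)
    (hX : ContMDiff (𝓡 m) (𝓡 m).tangent ∞ (fun x => (⟨x, X x⟩ : TangentBundle (𝓡 m) M)))
    {t : ℝ} (ht : t ∈ q.target) :
    DifferentiableAt ℝ (coordField q X) t := by
  have : IsManifold (𝓡 m) 1 M := IsManifold.of_le (n := ∞) (by simp)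
  have h1 := ContMDiffAt.mpullback_vectorField_preimage (m := 1) (n := ∞) (x₀ := t)
    ((hX.contMDiffAt (x := q.symm t)).of_le (by simp))
    (hqs.contMDiffAt (q.open_target.mem_nhds ht)) (mfderiv_symm_isInvertible hq ht)
    (by norm_cast)
  exact (contMDiffAt_vectorSpace_iff_contDiffAt.mp h1).differentiableAt (by simp)

open Filter Topology

variable [T2Space M] {f : ℝ ≃o ℝ} {Φ : M ≃ M} {γ : M → ℝ → M}

/-- Let `Φ` be the time `1` map of the flow `γ` of `X`. Near a point where `Φ` is a homothety in the
coordinate `q`, so is the time `1 / 2` map. Indeed `X` is invariant under `Φ`, so that it is linear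
there and its flow is explicit. -/
theorem exists_flow_half_eq (hq : q.MDifferentiable (𝓡 m) 𝓘(ℝ, ℝ))
    (hqs : ContMDiffOn 𝓘(ℝ, ℝ) (𝓡 m) ∞ q.symm q.target)
    (hX : ContMDiff (𝓡 m) (𝓡 m).tangent ∞ (fun x => (⟨x, X x⟩ : TangentBundle (𝓡 m) M)))
    (hγ : ∀ x, IsMIntegralCurve (I := 𝓡 m) (γ x) X) (hγ0 : ∀ x, γ x 0 = x)
    (hγ1 : ∀ x, γ x 1 = Φ x) (hγs : ∀ x s t, γ (γ x s) t = γ x (t + s))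
    (h : IsModelledOn q f Φ) {i l : ℝ} (hi : i ∈ q.target) (hl : 0 < l) (hl1 : l ≠ 1)
    (hfl : ∀ᶠ w in 𝓝 (0 : ℝ), f (i + w) = i + l * w) :
    ∃ κ : ℝ, ∀ᶠ w in 𝓝 (0 : ℝ), γ (q.symm (i + w)) (1 / 2) = q.symm (i + κ * w) := by
  have : IsManifold (𝓡 m) 1 M := IsManifold.of_le (n := ∞) (by simp)
  have hit : ∀ᶠ w in 𝓝 (0 : ℝ), i + w ∈ q.target :=
    (continuous_const.add continuous_id).continuousAt.eventually
      (q.open_target.mem_nhds (by simpa using hi))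
  obtain ⟨ρ, hρ, hball⟩ := Metric.eventually_nhds_iff.mp (hfl.and hit)
  simp only [dist_zero_right, Real.norm_eq_abs] at hball
  set V := coordField q X
  have hinv : ∀ w, |w| < ρ → V (i + l * w) = l * V (i + w) := by
    intro w hw
    obtain ⟨hfw, hwt⟩ := hball hw
    set x := q.symm (i + w)
    have hx : x ∈ q.source := q.map_target hwt
    have hqx : q x = i + w := q.right_inv hwt
    have hfwt : i + l * w ∈ q.target := hfw ▸ h.mapsTo hwt
    have hx1 : γ x 1 = q.symm (i + l * w) := by rw [hγ1, h.apply_symm _ hwt, hfw]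
    have d0 : HasDerivAt (q ∘ γ x) (V (i + w)) 0 := by
      have := hasDerivAt_comp_of_isMIntegralCurve hq (hγ x) (t := 0) (by rwa [hγ0])
      rwa [hγ0, hqx] at this
    have d1 : HasDerivAt (q ∘ γ x) (V (i + l * w)) 1 := by
      have := hasDerivAt_comp_of_isMIntegralCurve hq (hγ x) (t := 1)
        (by rw [hx1]; exact q.map_target hfwt)
      rwa [hx1, q.right_inv hfwt] at this
    have d2 : HasDerivAt (fun t => (q ∘ γ x) (t + 1)) (V (i + l * w)) 0 :=
      HasDerivAt.comp_add_const 0 1 (by rwa [zero_add])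
    have d3 : HasDerivAt (fun t => i + l * ((q ∘ γ x) t - i)) (l * V (i + w)) 0 :=
      ((d0.sub_const i).const_mul l).const_add i
    refine d2.unique (d3.congr_of_eventuallyEq ?_)
    have hc : ContinuousAt (γ x) 0 := (hγ x 0).continuousAt
    have e1 : ∀ᶠ t in 𝓝 (0 : ℝ), γ x t ∈ q.source :=
      hc.eventually (q.open_source.mem_nhds (by rwa [hγ0]))
    have e2 : ∀ᶠ t in 𝓝 (0 : ℝ), |(q ∘ γ x) t - i| < ρ := by
      have : ContinuousAt (fun t => |(q ∘ γ x) t - i|) 0 := (d0.continuousAt.sub_const i).abs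
      refine this.eventually (Iio_mem_nhds ?_)
      simpa [hγ0, hqx] using hw
    filter_upwards [e1, e2] with t ht1 ht2
    obtain ⟨h1, h2⟩ := hball ht2
    simp only [Function.comp] at h1 h2 ⊢
    rw [add_sub_cancel] at h1 h2
    rw [add_comm t 1, ← hγs, hγ1]
    conv_lhs => rw [← q.left_inv ht1, h.apply_symm _ h2, q.right_inv (h.mapsTo h2), h1]
  have hV0 : V i = 0 := by
    have := hinv 0 (by simpa using hρ)
    simp only [mul_zero, add_zero] at this
    have h2 : (l - 1) * V i = 0 := by linarith
    exact (mul_eq_zero.mp h2).resolve_left (sub_ne_zero.mpr hl1)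
  obtain ⟨A, hA⟩ : ∃ A, HasDerivAt V A i :=
    ⟨_, (differentiableAt_coordField hq hqs hX hi).hasDerivAt⟩
  have hpos : ∀ w ∈ Ioo 0 ρ, V (i + w) = A * w :=
    eq_mul_of_commute (G := fun w => V (i + w)) hl hl1
      (HasDerivAt.comp_const_add i 0 (by simpa using hA)) (by simpa using hV0)
      (fun w hw _ => hinv w (by rw [abs_of_pos hw.1]; exact hw.2))
  have hneg : ∀ w ∈ Ioo 0 ρ, -V (i - w) = A * w := by
    refine eq_mul_of_commute (G := fun w => -V (i - w)) hl hl1 ?_ (by simpa using hV0)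
      (fun w hw _ => ?_)
    · have := (HasDerivAt.comp_const_sub i 0 (f := V) (f' := A) (by simpa using hA)).neg
      rw [neg_neg] at this
      exact this
    · have := hinv (-w) (by rw [abs_neg, abs_of_pos hw.1]; exact hw.2)
      rw [mul_neg, ← sub_eq_add_neg, ← sub_eq_add_neg] at this
      rw [this]; ring
  have hlin : ∀ w, |w| < ρ → V (i + w) = A * w := by
    intro w hw
    rcases lt_trichotomy w 0 with h1 | h1 | h1
    · have := hneg (-w) ⟨by linarith, by rwa [abs_of_neg h1] at hw⟩
      rw [sub_neg_eq_add] at this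
      linarith
    · simp [h1, hV0]
    · exact hpos w ⟨h1, by rwa [abs_of_pos h1] at hw⟩
  refine ⟨Real.exp (A * (1 / 2)), ?_⟩
  have hsmall : ∀ᶠ w in 𝓝 (0 : ℝ), |w| * Real.exp |A| < ρ :=
    (continuous_abs.mul continuous_const).continuousAt.eventually (Iio_mem_nhds (by simpa using hρ))
  filter_upwards [hsmall] with w hw
  set y : ℝ → ℝ := fun t => i + Real.exp (A * t) * w with hy
  have hyt : ∀ t ∈ Ioo (-1 : ℝ) 1, |Real.exp (A * t) * w| < ρ := by
    intro t ht
    rw [abs_mul, abs_of_pos (Real.exp_pos _), mul_comm]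
    refine lt_of_le_of_lt ?_ hw
    gcongr
    calc A * t ≤ |A * t| := le_abs_self _
      _ = |A| * |t| := abs_mul _ _
      _ ≤ |A| * 1 := by gcongr; exact (abs_lt.mpr ht).le
      _ = |A| := mul_one _
  have hcurve : IsMIntegralCurveOn (I := 𝓡 m) (q.symm ∘ y) X (Ioo (-1) 1) := by
    refine isMIntegralCurveOn_symm_comp hq (fun t ht => (hball (hyt t ht)).2) fun t ht => ?_
    have : coordField q X (y t) = Real.exp (A * t) * (A * 1) * w :=
      (hlin _ (hyt t ht)).trans (by ring)
    rw [this]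
    exact ((((hasDerivAt_id t).const_mul A).exp).mul_const w).const_add i
  have heq := isMIntegralCurveOn_Ioo_eqOn_of_contMDiff_boundaryless (t₀ := 0) (by norm_num)
    (hX.of_le (by simp)) ((hγ (q.symm (i + w))).isMIntegralCurveOn (Ioo (-1) 1)) hcurve
    (by simp [hγ0, hy])
  exact heq (show (1 / 2 : ℝ) ∈ Ioo (-1 : ℝ) 1 by norm_num)

/-- The time `1 / 2` map of a flow is a tame square root of its time `1` map. -/
theorem isTameSqrt_flow_half (hq : q.MDifferentiable (𝓡 m) 𝓘(ℝ, ℝ))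
    (hqs : ContMDiffOn 𝓘(ℝ, ℝ) (𝓡 m) ∞ q.symm q.target)
    (hX : ContMDiff (𝓡 m) (𝓡 m).tangent ∞ (fun x => (⟨x, X x⟩ : TangentBundle (𝓡 m) M)))
    (hγ : ∀ x, IsMIntegralCurve (I := 𝓡 m) (γ x) X) (hγ0 : ∀ x, γ x 0 = x)
    (hγ1 : ∀ x, γ x 1 = Φ x) (hγs : ∀ x s t, γ (γ x s) t = γ x (t + s))
    (h : IsModelledOn q f Φ) {s : ℝ} (hs0 : 0 < s) (hs1 : s < 1)
    (hf : IsHyperbolicNorthSouth s f) : IsTameSqrt q Φ (fun x => γ x (1 / 2)) := by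
  have hit : ∀ i : ℝ, i = -1 ∨ i = 1 → i ∈ q.target := by
    rintro i (rfl | rfl) <;> exact h.mem_target (by norm_num) (by norm_num)
  have key : ∀ i : ℝ, i = -1 ∨ i = 1 →
      ∃ κ : ℝ, ∀ᶠ w in 𝓝 (0 : ℝ), γ (q.symm (i + w)) (1 / 2) = q.symm (i + κ * w) := by
    rintro i (rfl | rfl)
    · exact exists_flow_half_eq hq hqs hX hγ hγ0 hγ1 hγs h (hit _ (Or.inl rfl)) (by linarith)
        (by linarith) hf.near_neg_one
    · exact exists_flow_half_eq hq hqs hX hγ hγ0 hγ1 hγs h (hit _ (Or.inr rfl)) (by linarith)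
        (by linarith) hf.near_one
  refine ⟨fun x => ?_, fun i hi => ?_, fun i hi => ?_, fun i hi => ?_⟩
  · rw [hγs, ← hγ1]; norm_num
  · obtain ⟨κ, hκ⟩ := key i hi
    simpa using hκ.self_of_nhds
  · obtain ⟨κ, hκ⟩ := key i hi
    have hqi := q.map_target (hit i hi)
    have h1 : Tendsto (fun x => q x - i) (𝓝 (q.symm i)) (𝓝 0) := by
      have h : ContinuousAt (fun x => q x - i) (q.symm i) := (q.continuousAt hqi).sub_const i
      rwa [ContinuousAt, q.right_inv (hit i hi), sub_self] at h
    have h2 : ContinuousAt (fun x => q.symm (i + κ * (q x - i))) (q.symm i) := by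
      refine ContinuousAt.comp (g := q.symm) (q.continuousAt_symm ?_)
        ((((q.continuousAt hqi).sub_const i).const_mul κ).const_add i)
      rw [q.right_inv (hit i hi)]; simpa using hit i hi
    refine h2.congr_of_eventuallyEq ?_
    filter_upwards [h1.eventually hκ, q.open_source.mem_nhds hqi] with x hx hxs
    rwa [add_sub_cancel, q.left_inv hxs] at hx
  · obtain ⟨κ, hκ⟩ := key i hi
    have h1 : Tendsto (fun t => t - i) (𝓝 i) (𝓝 0) := by
      have h : ContinuousAt (fun t : ℝ => t - i) i := by fun_prop
      rw [ContinuousAt, sub_self] at h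
      exact h
    have h2 : ∀ᶠ t in 𝓝 i, i + κ * (t - i) ∈ q.target := by
      have : ContinuousAt (fun t : ℝ => i + κ * (t - i)) i := by fun_prop
      exact this.eventually (q.open_target.mem_nhds (by simpa using hit i hi))
    have h3 : DifferentiableAt ℝ (fun t : ℝ => i + κ * (t - i)) i := by fun_prop
    refine h3.congr_of_eventuallyEq ?_
    filter_upwards [h1.eventually hκ, h2] with t ht ht'
    rw [add_sub_cancel] at ht
    simp only [Function.comp, ht, q.right_inv ht']

omit [IsManifold (𝓡 m) ∞ M] in
/-- A smooth square root is tame. -/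
theorem isTameSqrt_of_diff (hqc : ContMDiffOn (𝓡 m) 𝓘(ℝ, ℝ) ∞ q q.source)
    (hqs : ContMDiffOn 𝓘(ℝ, ℝ) (𝓡 m) ∞ q.symm q.target) (h : IsModelledOn q f Φ)
    (hf : IsNorthSouth f) (D : Diff m M) (hD : ∀ x, D (D x) = Φ x) : IsTameSqrt q Φ D := by
  have hcomm : ∀ x, D.toHomeomorph (Φ x) = Φ (D.toHomeomorph x) := fun x => by
    change D (Φ x) = Φ (D x)
    rw [← hD, ← hD]
  have hfix : ∀ i : ℝ, i = -1 ∨ i = 1 → D (q.symm i) = q.symm i := by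
    rintro i (rfl | rfl)
    · exact h.apply_symm_neg_one_eq hf D.toHomeomorph hcomm
    · exact h.apply_symm_one_eq hf D.toHomeomorph hcomm
  refine ⟨hD, hfix, fun i _ => D.continuous.continuousAt, fun i hi => ?_⟩
  have hit : i ∈ q.target := by
    rcases hi with rfl | rfl <;> exact h.mem_target (by norm_num) (by norm_num)
  have h1 : ContMDiffAt 𝓘(ℝ, ℝ) (𝓡 m) ∞ q.symm i :=
    hqs.contMDiffAt (q.open_target.mem_nhds hit)
  have h2 : ContMDiffAt (𝓡 m) 𝓘(ℝ, ℝ) ∞ q (D (q.symm i)) := by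
    rw [hfix i hi]
    exact hqc.contMDiffAt (q.open_source.mem_nhds (q.map_target hit))
  have h3 : ContMDiffAt 𝓘(ℝ, ℝ) 𝓘(ℝ, ℝ) ∞ (q ∘ D ∘ q.symm) i :=
    ContMDiffAt.comp i h2 (D.contMDiff.contMDiffAt.comp i h1)
  exact (contMDiffAt_iff_contDiffAt.mp h3).differentiableAt (by simp)

end PulledBackField

/-! ### Dimension one -/

section DimensionOne

open Filter Topology

theorem exists_linearIsometryEquiv_real :
    Nonempty (EuclideanSpace ℝ (Fin 1) ≃ₗᵢ[ℝ] ℝ) :=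
  ⟨(OrthonormalBasis.singleton (Fin 1) ℝ).repr.symm⟩

variable {M : Type*} [TopologicalSpace M]

theorem isModelledOn_of_chartExt (L : EuclideanSpace ℝ (Fin 1) ≃ₗᵢ[ℝ] ℝ)
    {c : OpenPartialHomeomorph M (EuclideanSpace ℝ (Fin 1))}
    (hball : Metric.closedBall 0 3 ⊆ c.target) {w : ℝ → ℝ}
    (hmaps : MapsTo (fun y => y + L.symm (w (L y))) c.target c.target) {f : ℝ ≃o ℝ}
    (hf : ∀ t, f t = t + w t) (Φ : M ≃ M)
    (hΦ : ∀ x, Φ x = chartExt c (fun y => y + L.symm (w (L y))) x) :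
    IsModelledOn (c.transHomeomorph L.toHomeomorph) f Φ := by
  have hfL : ∀ t, L.symm (f t) = L.symm t + L.symm (w (L (L.symm t))) := fun t => by
    rw [hf, map_add, L.apply_symm_apply]
  refine ⟨fun t ht => ?_, fun t ht => ?_, fun t ht => ?_, fun x hx => ?_⟩
  · change L.symm t ∈ c.target
    apply hball
    rw [mem_closedBall_zero_iff, L.symm.norm_map, Real.norm_eq_abs]
    exact abs_le.mpr ht
  · change L.symm (f t) ∈ c.target
    rw [hfL]
    exact hmaps ht
  · change Φ (c.symm (L.symm t)) = c.symm (L.symm (f t))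
    have ht' : L.symm t ∈ c.target := ht
    rw [hΦ, chartExt_symm ht', hfL]
  · rw [hΦ, chartExt_of_notMem hx]

variable [T2Space M] [Nonempty M] [ChartedSpace (EuclideanSpace ℝ (Fin 1)) M]
  [IsManifold (𝓡 1) ∞ M]

/-- In dimension one, there are diffeomorphisms arbitrarily close to the identity without any
tame square root. If a diffeomorphism given by `t + s * lineField t` in a coordinate has a tame
square root, then its perturbation in a fundamental domain of this root has none. -/
theorem exists_mem_forall_not_isTameSqrt (W : Set (DiffC0 1 M)) (hW : IsOpen W)
    (hid : (⟨DiffC.id, id_mem_DiffC0⟩ : DiffC0 1 M) ∈ W) :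
    ∃ φ ∈ W, ∃ (q : OpenPartialHomeomorph M ℝ) (f : ℝ ≃o ℝ) (s : ℝ),
      ContMDiffOn (𝓡 1) 𝓘(ℝ, ℝ) ∞ q q.source ∧ ContMDiffOn 𝓘(ℝ, ℝ) (𝓡 1) ∞ q.symm q.target ∧
      0 < s ∧ s < 1 ∧ IsHyperbolicNorthSouth s f ∧
      IsModelledOn q f φ.1.toDiff.toEquiv ∧ ∀ ψ, ¬ IsTameSqrt q φ.1.toDiff ψ := by
  obtain ⟨L⟩ := exists_linearIsometryEquiv_real
  obtain ⟨c, hc, hball⟩ :=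
    exists_chart_closedBall_subset (m := 1) (M := M) (Classical.arbitrary M) 3
  have hLc : ContDiff ℝ ∞ L := L.contDiff
  have hLsc : ContDiff ℝ ∞ L.symm := L.symm.contDiff
  set q := c.transHomeomorph L.toHomeomorph with hq
  have hqc : ContMDiffOn (𝓡 1) 𝓘(ℝ, ℝ) ∞ q q.source :=
    hLc.contMDiff.comp_contMDiffOn (contMDiffOn_of_mem_maximalAtlas hc)
  have hqs : ContMDiffOn 𝓘(ℝ, ℝ) (𝓡 1) ∞ q.symm q.target :=
    (contMDiffOn_symm_of_mem_maximalAtlas hc).comp hLsc.contMDiff.contMDiffOn (fun y hy => hy)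
  have hK : IsCompact (Metric.closedBall (0 : EuclideanSpace ℝ (Fin 1)) 2) :=
    isCompact_closedBall _ _
  have hKt : Metric.closedBall (0 : EuclideanSpace ℝ (Fin 1)) 2 ⊆ c.target :=
    (Metric.closedBall_subset_closedBall (by norm_num)).trans hball
  -- the displacement, in the coordinate and in the model space
  let w : ℝ → ℝ → ℝ → ℝ → ℝ := fun x s ε t => s * lineField t + ε * lineBump x t
  let u : ℝ → ℝ → ℝ → EuclideanSpace ℝ (Fin 1) → EuclideanSpace ℝ (Fin 1) :=
    fun x s ε y => L.symm (w x s ε (L y))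
  have hw0 : ∀ x < 1, ∀ s ε t, 2 ≤ |t| → w x s ε t = 0 := fun x hx s ε t ht => by
    have : t ∉ Ioo 0 x := fun h => by rw [abs_of_pos h.1] at ht; linarith [h.2]
    simp [w, lineField_eq_zero ht, lineBump_eq_zero this]
  have hoff : ∀ x < 1, ∀ s ε, ∀ y ∉ Metric.closedBall (0 : EuclideanSpace ℝ (Fin 1)) 2,
      u x s ε y = 0 := fun x hx s ε y hy => by
    rw [mem_closedBall_zero_iff, not_le, ← L.norm_map, Real.norm_eq_abs] at hy
    simp only [u, hw0 x hx s ε _ hy.le, map_zero]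
  have hsmooth : ∀ x, ContDiff ℝ ∞
      (fun p : (ℝ × ℝ) × EuclideanSpace ℝ (Fin 1) => u x p.1.1 p.1.2 p.2) := fun x => by
    have h1 : ContDiff ℝ ∞ (fun p : (ℝ × ℝ) × EuclideanSpace ℝ (Fin 1) => L p.2) :=
      hLc.comp contDiff_snd
    exact hLsc.comp ((contDiff_fst.fst.mul (contDiff_lineField.comp h1)).add
      (contDiff_fst.snd.mul ((contDiff_lineBump x).comp h1)))
  -- the map of the line and its properties
  have hmodel : ∀ x < 1, ∀ s ε, 0 < s → 0 ≤ ε →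
      (∀ y, ‖fderiv ℝ (u x s ε) y‖ < (2⁻¹ : NNReal)) →
      MapsTo (fun y => y + u x s ε y) c.target c.target → ∀ Φ : M ≃ M,
      (∀ p, Φ p = chartExt c (fun y => y + u x s ε y) p) →
      ∃ f : ℝ ≃o ℝ, (∀ t, f t = t + w x s ε t) ∧ IsHyperbolicNorthSouth s f ∧
        IsModelledOn q f Φ := by
    intro x hx s ε hs hε hk hmaps Φ hΦ
    have hus : ContDiff ℝ ∞ (u x s ε) :=
      (hsmooth x).comp (f := fun y => ((s, ε), y)) (contDiff_const.prodMk contDiff_id)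
    have hlip : LipschitzWith 2⁻¹ (u x s ε) := lipschitzWith_of_nnnorm_fderiv_le
      (hus.differentiable (by simp)) fun y => by exact_mod_cast (hk y).le
    have hlip' : LipschitzWith 2⁻¹ (w x s ε) := LipschitzWith.of_dist_le_mul fun a b => by
      have := hlip.dist_le_mul (L.symm a) (L.symm b)
      simpa only [u, L.symm.dist_map, L.apply_symm_apply] using this
    obtain ⟨f, hf⟩ := exists_orderIso_add (by rw [← NNReal.coe_lt_coe]; norm_num) hlip'
      (hw0 x hx s ε)
    exact ⟨f, hf, isHyperbolicNorthSouth_of_eq hs hε hx hf,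
      isModelledOn_of_chartExt L hball hmaps hf Φ hΦ⟩
  have hu0 : ∀ x s, u x s 0 = u 0 s 0 := fun x s => by funext y; simp [u, w]
  have hstep1 := eventually_exists_mem_of_family (u := fun s => u 0 s 0) (t₀ := 0) hc hK hKt
    ((hsmooth 0).comp (f := fun p : ℝ × EuclideanSpace ℝ (Fin 1) => ((p.1, (0 : ℝ)), p.2))
      ((contDiff_fst.prodMk contDiff_const).prodMk contDiff_snd))
    (fun s => hoff 0 one_pos s 0) (fun y => by
      rw [show u 0 0 0 = fun _ => 0 by funext y; simp [u, w]]
      simp) hW hid (fun x => by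
      simp only [u, w, zero_mul, add_zero, map_zero, chartExt_id]; rfl)
  obtain ⟨s, ⟨⟨hk0, hmaps0, φ₀, hφ₀, hφ₀'⟩, hs1⟩, hs0⟩ :=
    (((hstep1.and (gt_mem_nhds one_pos)).filter_mono nhdsWithin_le_nhds).and
      (self_mem_nhdsWithin (s := Ioi (0 : ℝ)))).exists
  obtain ⟨f₀, hf₀w, hf₀, hmod₀⟩ :=
    hmodel 0 one_pos s 0 hs0 le_rfl hk0 hmaps0 φ₀.1.toDiff.toEquiv hφ₀'
  -- Either this map has no tame square root, or the fundamental domain `(0, g₀ 0)` of a tame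
  -- square root `g₀` supports a perturbation without one.
  by_cases hroot : ∃ ψ, IsTameSqrt q φ₀.1.toDiff ψ
  swap
  · exact ⟨φ₀, hφ₀, q, f₀, s, hqc, hqs, hs0, hs1, hf₀, hmod₀, not_exists.mp hroot⟩
  obtain ⟨ψ₀, hψ₀⟩ := hroot
  have hg₀ := hmod₀.isTameRoot hf₀.toIsNorthSouth hψ₀
  set g₀ := q ∘ ψ₀ ∘ q.symm
  have h0 : (0 : ℝ) ∈ Ioo (-1 : ℝ) 1 := by norm_num
  have hx1 : g₀ 0 < 1 := (hg₀.mapsTo h0).2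
  have hx0 : 0 < g₀ 0 := hg₀.lt_apply hf₀ hs0 h0
  set x := g₀ 0
  have hstep2 := eventually_exists_mem_of_family (u := fun ε => u x s ε) (t₀ := 0) hc hK hKt
    ((hsmooth x).comp (f := fun p : ℝ × EuclideanSpace ℝ (Fin 1) => ((s, p.1), p.2))
      ((contDiff_const.prodMk contDiff_fst).prodMk contDiff_snd))
    (fun ε => hoff x hx1 s ε) (by rw [hu0]; exact hk0) hW hφ₀ (by rw [hu0]; exact hφ₀')
  obtain ⟨ε, ⟨hk, hmaps, φ, hφ, hφ'⟩, hε⟩ :=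
    ((hstep2.filter_mono nhdsWithin_le_nhds).and
      (self_mem_nhdsWithin (s := Ioi (0 : ℝ)))).exists
  obtain ⟨f, hfw, hf, hmod⟩ :=
    hmodel x hx1 s ε hs0 (le_of_lt hε) hk hmaps φ.1.toDiff.toEquiv hφ'
  refine ⟨φ, hφ, q, f, s, hqc, hqs, hs0, hs1, hf, hmod, fun ψ hψ => ?_⟩
  have hg := hmod.isTameRoot hf.toIsNorthSouth hψ
  have hmid : x / 2 ∈ Ioo 0 x := ⟨by linarith, by linarith⟩
  have heq : f (x / 2) = f₀ (x / 2) := by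
    refine hg₀.eq_of_eqOn_compl hf₀ hs0 hs1 hg hf (fun t ht => ?_) hmid
    rw [hfw, hf₀w]
    have hb : lineBump x t = 0 := lineBump_eq_zero ht
    simp [w, hb]
  rw [hfw, hf₀w] at heq
  simp only [w, zero_mul, add_zero] at heq
  have := mul_pos hε (lineBump_pos hmid)
  linarith

end DimensionOne

end SmoothDiff

theorem theorem2 {m : ℕ} (hm : 1 ≤ m) {M : Type*} [TopologicalSpace M] [T2Space M] [Nonempty M]
    [ChartedSpace (EuclideanSpace ℝ (Fin m)) M] [IsManifold (𝓡 m) ∞ M]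
    (W : Set (SmoothDiff.DiffC0 m M)) (hW : IsOpen W)
    (hid : (⟨SmoothDiff.DiffC.id, SmoothDiff.id_mem_DiffC0⟩ : SmoothDiff.DiffC0 m M) ∈ W) :
    (∃ φ ∈ W, ∀ ψ : SmoothDiff.DiffC m M, φ.1.toDiff ≠ ψ.toDiff.trans ψ.toDiff) ∧
      (∃ φ ∈ W, φ.1 ∉ SmoothDiff.Aut m M) := by
  rcases hm.eq_or_lt with rfl | hm
  · obtain ⟨φ, hφ, q, f, s, hqc, hqs, hs0, hs1, hf, hmod, hno⟩ :=
      SmoothDiff.exists_mem_forall_not_isTameSqrt W hW hid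
    refine ⟨⟨φ, hφ, fun ψ hψ => hno ψ.toDiff ?_⟩, φ, hφ, fun hA => ?_⟩
    · refine SmoothDiff.isTameSqrt_of_diff hqc hqs hmod hf.toIsNorthSouth ψ.toDiff fun x => ?_
      exact (DFunLike.congr_fun hψ x).symm
    · obtain ⟨X, γ, hX, hγ, h0, h1, hs⟩ := SmoothDiff.exists_flow_of_mem_Aut hA
      exact hno _ (SmoothDiff.isTameSqrt_flow_half
        ⟨hqc.mdifferentiableOn (by simp), hqs.mdifferentiableOn (by simp)⟩ hqs hX hγ h0 h1 hs hmod
        hs0 hs1 hf)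
  · obtain ⟨φ, hφ, hno⟩ := SmoothDiff.exists_mem_forall_ne_sqrt_of_two_le hm W hW hid
    refine ⟨⟨φ, hφ, fun ψ hψ => hno ψ.toDiff fun x => (DFunLike.congr_fun hψ x).symm⟩,
      φ, hφ, fun hA => ?_⟩
    obtain ⟨X, γ, -, -, h0, h1, hs⟩ := SmoothDiff.exists_flow_of_mem_Aut hA
    refine hno (fun x => γ x (1 / 2)) fun x => ?_
    rw [hs, ← h1]; norm_num
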